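/- Let $(M,\tau)$ be a tracial $W^*$-probability space, i.e. $M$ is a von Neumann algebra and $\tau$ is a faithful normal tracial state on $M$, and let $X=(X_1,\dots,X_n)$ be self-adjoint elements of $M$. Write $\|\cdot\|$ for the operator norm of $M$, $\|a\|_2=\tau(a^*a)^{1/2}$ and, also, $\|\cdot\|_2$ for the norm of $L^2(M,\tau)$. Let $\mathrm{vN}(X)\subseteq M$ be the von Neumann algebra and $\mathbb{C}\langle X\rangle\subseteq M$ the unital algebra generated by $X_1,\dots,X_n$. Let $\mathbb{C}\langle Z_1,\dots,Z_n\rangle$ be the algebra of non-commutative polynomials, and let $\partial_i:\mathbb{C}\langle Z\rangle\to\mathbb{C}\langle Z\rangle\otimes\mathbb{C}\langle Z\rangle$ be the linear map determined by $\partial_iZ_j=\delta_{ij}\,1\otimes1$ and $\partial_i(PQ)=(\partial_iP)(1\otimes Q)+(P\otimes1)(\partial_iQ)$. For $P\in\mathbb{C}\langle Z\rangle$ write $P(X)\in\mathbb{C}\langle X\rangle$ and $(\partial_iP)(X)\in\mathbb{C}\langle X\rangle\otimes\mathbb{C}\langle X\rangle$ for the evaluations at $X$. A conjugate system for $X$ is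 a tuple $(\xi_1,\dots,\xi_n)$ of elements of the closure of $\mathbb{C}\langle X\rangle$ in $L^2(M,\tau)$ such that $(\tau\otimes\tau)((\partial_jP)(X))=\tau(\xi_jP(X))$ for all $P\in\mathbb{C}\langle Z\rangle$ and $j=1,\dots,n$; it is unique if it exists. Put $\Phi^*(X)=\sum_{j=1}^n\|\xi_j\|_2^2$ if it exists and $\Phi^*(X)=\infty$ otherwise. For $A,B$ in the algebraic tensor product $M\otimes M$ let $\langle A,B\rangle=(\tau\otimes\tau)(AB^*)$, where $(a\otimes b)^*=a^*\otimes b^*$, and for $u,v\in M$ let $v^*Au=(v^*\otimes1)\,A\,(1\otimes u)$. For $Q\in\mathbb{C}\langle X\rangle\otimes\mathbb{C}\langle X\rangle$ let $$\|Q\|_\pi=\inf\Big\{\sum_{k=1}^N\|Q_{k,1}\|\,\|Q_{k,2}\| \;:\; Q=\sum_{k=1}^NQ_{k,1}\otimes Q_{k,2},\ Q_{k,1},Q_{k,2}\in\mathbb{C}\langle X\rangle\Big\}.$$ **Proposition.** Suppose that $\Phi^*(X_1,\dots,X_n)<\infty$ and let $(\xi_1,\dots,\xi_n)$ be the conjugate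 system for $X$. Then for all $P\in\mathbb{C}\langle Z_1,\dots,Z_n\rangle$, all $u,v\in\mathrm{vN}(X)$, all $Q\in\mathbb{C}\langle X\rangle\otimes\mathbb{C}\langle X\rangle$ and all $i=1,\dots,n$, $$|\langle v^*(\partial_iP)(X)u,\,Q\rangle|\le4\,\|\xi_i\|_2\,\big(\|P(X)u\|_2\,\|v\|+\|u\|\,\|P(X)^*v\|_2\big)\,\|Q\|_\pi .$$ In particular, $$\sum_{i=1}^n|\langle v^*(\partial_iP)(X)u,\,Q\rangle|^2\le16\,\big(\|P(X)u\|_2\,\|v\|+\|u\|\,\|P(X)^*v\|_2\big)^2\,\Phi^*(X_1,\dots,X_n)\,\|Q\|_\pi^2 .$$ -/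

import Mathlib

open scoped TensorProduct ENNReal ComplexOrder

noncomputable section

/-! ### Non-commutative polynomials and the non-commutative derivatives -/

namespace NCPoly

/-- The algebra homomorphism `ℂ⟨Z₁,…,Zₙ⟩ → Mat₂(ℂ⟨Z⟩ ⊗ ℂ⟨Z⟩)` with
`Zᵢ ↦ !![Zᵢ ⊗ 1, δᵢⱼ 1 ⊗ 1; 0, 1 ⊗ Zᵢ]`. Its upper right entry is a derivation for the bimodule
structure `a · (b ⊗ c) · d = ab ⊗ cd`. -/
def triangularHom {n : ℕ} (j : Fin n) :
    FreeAlgebra ℂ (Fin n) →ₐ[ℂ]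
      Matrix (Fin 2) (Fin 2) (FreeAlgebra ℂ (Fin n) ⊗[ℂ] FreeAlgebra ℂ (Fin n)) :=
  FreeAlgebra.lift ℂ fun i =>
    !![FreeAlgebra.ι ℂ i ⊗ₜ 1, if i = j then 1 else 0; 0, 1 ⊗ₜ FreeAlgebra.ι ℂ i]

/-- The non-commutative derivative `∂ⱼ : ℂ⟨Z₁,…,Zₙ⟩ → ℂ⟨Z₁,…,Zₙ⟩ ⊗ ℂ⟨Z₁,…,Zₙ⟩`. It is the linear
map determined by `∂ⱼ Zᵢ = δᵢⱼ 1 ⊗ 1` and `∂ⱼ (P Q) = (∂ⱼ P)(1 ⊗ Q) + (P ⊗ 1)(∂ⱼ Q)`, see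
`NCPoly.partialDeriv_ι` and `NCPoly.partialDeriv_mul`. -/
def partialDeriv {n : ℕ} (j : Fin n) :
    FreeAlgebra ℂ (Fin n) →ₗ[ℂ] FreeAlgebra ℂ (Fin n) ⊗[ℂ] FreeAlgebra ℂ (Fin n) where
  toFun P := triangularHom j P 0 1
  map_add' P Q := by simp
  map_smul' c P := by simp

theorem triangularHom_diag {n : ℕ} (j : Fin n) (P : FreeAlgebra ℂ (Fin n)) :
    triangularHom j P 0 0 = P ⊗ₜ 1 ∧ triangularHom j P 1 0 = 0 ∧
      triangularHom j P 1 1 = 1 ⊗ₜ P := by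
  induction P using FreeAlgebra.induction with
  | grade0 r =>
    simp [Algebra.algebraMap_eq_smul_one, TensorProduct.smul_tmul,
      Algebra.TensorProduct.one_def]
  | grade1 i => simp [triangularHom]
  | mul a b ha hb =>
    obtain ⟨h1, h2, h3⟩ := ha
    obtain ⟨h4, h5, h6⟩ := hb
    simp [Matrix.mul_apply, Fin.sum_univ_two, *]
  | add a b ha hb =>
    obtain ⟨h1, h2, h3⟩ := ha
    obtain ⟨h4, h5, h6⟩ := hb
    simp [*, TensorProduct.add_tmul, TensorProduct.tmul_add]

theorem partialDeriv_ι {n : ℕ} (j i : Fin n) :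
    partialDeriv j (FreeAlgebra.ι ℂ i) = if i = j then 1 ⊗ₜ 1 else 0 := by
  simp [partialDeriv, triangularHom, Algebra.TensorProduct.one_def]

theorem partialDeriv_mul {n : ℕ} (j : Fin n) (P Q : FreeAlgebra ℂ (Fin n)) :
    partialDeriv j (P * Q) = partialDeriv j P * (1 ⊗ₜ Q) + (P ⊗ₜ 1) * partialDeriv j Q := by
  have hP := triangularHom_diag j P
  have hQ := triangularHom_diag j Q
  simp [partialDeriv, Matrix.mul_apply, Fin.sum_univ_two, hP.1, hQ.2.2, add_comm]

end NCPoly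

/-! ### Tracial W*-probability spaces -/

section Ultraweak

variable (H : Type*) [NormedAddCommGroup H] [InnerProductSpace ℂ H] [CompleteSpace H]

/-- The ultraweak (σ-weak) topology on `B(H)`: the coarsest topology for which all functionals
`x ↦ ∑ₖ ⟪ηₖ, x ζₖ⟫` with `∑ₖ ‖ηₖ‖² < ∞` and `∑ₖ ‖ζₖ‖² < ∞` are continuous. -/
abbrev ultraweakTopology : TopologicalSpace (H →L[ℂ] H) :=
  ⨅ (p : {p : (ℕ → H) × (ℕ → H) //
      (Summable fun k => ‖p.1 k‖ ^ 2) ∧ Summable fun k => ‖p.2 k‖ ^ 2}),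
    TopologicalSpace.induced
      (fun x : H →L[ℂ] H => ∑' k, inner ℂ (p.1.1 k) (x (p.1.2 k))) inferInstance

/-- A tracial W*-probability space `(M, τ)`: a von Neumann algebra `M` (acting on the Hilbert
space `H`) together with a faithful normal tracial state `τ`. Normal means ultraweakly
continuous. -/
structure TracialWStarProbabilitySpace where
  /-- the von Neumann algebra -/
  vna : VonNeumannAlgebra H
  /-- the trace -/
  τ : vna.toStarSubalgebra →ₗ[ℂ] ℂ
  τ_one : τ 1 = 1
  τ_nonneg : ∀ a, 0 ≤ τ (star a * a)
  τ_faithful : ∀ a, τ (star a * a) = 0 → a = 0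
  τ_tracial : ∀ a b, τ (a * b) = τ (b * a)
  τ_normal : @Continuous _ _ ((ultraweakTopology H).induced Subtype.val) inferInstance τ

end Ultraweak

namespace TracialWStarProbabilitySpace

variable {H : Type*} [NormedAddCommGroup H] [InnerProductSpace ℂ H] [CompleteSpace H]
  (W : TracialWStarProbabilitySpace H)

/-- The elements of the von Neumann algebra, with its *-algebra structure and operator norm. -/
abbrev M : Type _ := W.vna.toStarSubalgebra

/-- A copy of `M`, to be equipped with the inner product given by the trace. -/
def PreL2 : Type _ := W.M

instance : AddCommGroup W.PreL2 := inferInstanceAs (AddCommGroup W.M)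

instance : Module ℂ W.PreL2 := inferInstanceAs (Module ℂ W.M)

/-- The identity map from `M` to its copy `PreL2`. -/
def toPreL2 : W.M ≃ₗ[ℂ] W.PreL2 := LinearEquiv.refl ℂ _

theorem τ_star (a : W.M) : W.τ (star a) = star (W.τ a) := by
  have h : ∀ b : W.M, (W.τ (star b * b)).im = 0 := fun b =>
    (Complex.nonneg_iff.1 (W.τ_nonneg b)).2.symm
  have h1 := h (1 + a)
  have h2 := h (1 + Complex.I • a)
  have h0 := h 1
  have ha := h a
  simp only [star_add, star_one, star_smul, add_mul, mul_add, one_mul, mul_one, map_add,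
    smul_mul_assoc, mul_smul_comm, map_smul, smul_eq_mul, Complex.add_im] at h1 h2 h0
  apply Complex.ext
  · simp [W.τ_one, ha] at h2 ⊢
    linarith
  · simp [W.τ_one, ha] at h1 ⊢
    linarith

/-- The inner product `⟨a, b⟩ = τ(a b*) = τ(b* a)`; in Mathlib the inner product is conjugate
linear in the first variable, so that `inner ℂ a b` stands for `⟨b, a⟩ = τ(a* b)`. -/
abbrev preL2Core : InnerProductSpace.Core ℂ W.PreL2 where
  inner a b := W.τ (star (W.toPreL2.symm a) * W.toPreL2.symm b)
  conj_inner_symm a b := by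
    have := W.τ_star (star (W.toPreL2.symm b) * W.toPreL2.symm a)
    rw [star_mul, star_star] at this
    exact this.symm
  re_inner_nonneg a := (Complex.nonneg_iff.1 (W.τ_nonneg _)).1
  add_left a b c := by simp [add_mul]
  smul_left a b c := by simp
  definite a h := by
    have := W.τ_faithful _ h
    simpa using this

instance : NormedAddCommGroup W.PreL2 :=
  @InnerProductSpace.Core.toNormedAddCommGroup ℂ W.PreL2 _ _ _ W.preL2Core

instance : InnerProductSpace ℂ W.PreL2 := InnerProductSpace.ofCore W.preL2Core.toCore

/-- The Hilbert space `L²(M, τ)`. -/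
abbrev L2 : Type _ := UniformSpace.Completion W.PreL2

/-- The canonical embedding `M → L²(M, τ)`. -/
def toL2 (a : W.M) : W.L2 := (W.toPreL2 a : UniformSpace.Completion W.PreL2)

theorem inner_toL2 (a b : W.M) : inner ℂ (W.toL2 a) (W.toL2 b) = W.τ (star a * b) :=
  UniformSpace.Completion.inner_coe _ _

/-- The expression `τ(ξ a)` for `ξ ∈ L²(M, τ)` and `a ∈ M`, i.e. the scalar product of `ξ`
with `a*`; it is the continuous extension of `b ↦ τ(b a)` from `M` to `L²(M, τ)`. -/
def τMul (ξ : W.L2) (a : W.M) : ℂ := inner ℂ (W.toL2 (star a)) ξ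

theorem τMul_toL2 (b a : W.M) : W.τMul (W.toL2 b) a = W.τ (b * a) := by
  rw [τMul, inner_toL2, star_star, W.τ_tracial]

theorem continuous_τMul (a : W.M) : Continuous fun ξ => W.τMul ξ a := by
  unfold τMul
  fun_prop

/-- The norm `‖a‖₂ = τ(a* a)^{1/2}`. -/
def norm2 (a : W.M) : ℝ := ‖W.toL2 a‖

theorem norm2_sq (a : W.M) : ((W.norm2 a ^ 2 : ℝ) : ℂ) = W.τ (star a * a) := by
  rw [norm2, ← W.inner_toL2, inner_self_eq_norm_sq_to_K]
  simp

/-- The functional `τ ⊗ τ` on the algebraic tensor product `M ⊗ M`. -/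
def ττ : W.M ⊗[ℂ] W.M →ₗ[ℂ] ℂ := LinearMap.mul' ℂ ℂ ∘ₗ TensorProduct.map W.τ W.τ

/-- The inner product `⟨A, B⟩ = (τ ⊗ τ)(A B*)` of `L²(M ⊗ M, τ ⊗ τ)`, restricted to the algebraic
tensor product `M ⊗ M`, where `(a ⊗ b)* = a* ⊗ b*`. -/
def ip (A B : W.M ⊗[ℂ] W.M) : ℂ := W.ττ (A * star B)

theorem ip_tmul (a b c d : W.M) :
    W.ip (a ⊗ₜ b) (c ⊗ₜ d) = W.τ (a * star c) * W.τ (b * star d) := by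
  simp [ip, ττ, TensorProduct.star_tmul]

variable {n : ℕ} (X : Fin n → W.M)

/-- The von Neumann subalgebra generated by `X₁,…,Xₙ`: all elements that lie in every von Neumann
algebra containing `X₁,…,Xₙ`. -/
def vN : Set W.M :=
  {a | ∀ N : VonNeumannAlgebra H, (∀ i, (X i : H →L[ℂ] H) ∈ N) → (a : H →L[ℂ] H) ∈ N}

/-- The evaluation homomorphism `P ↦ P(X)` on non-commutative polynomials. -/
def eval : FreeAlgebra ℂ (Fin n) →ₐ[ℂ] W.M := FreeAlgebra.lift ℂ X

/-- The evaluation `Q ↦ Q(X)` from `ℂ⟨Z⟩ ⊗ ℂ⟨Z⟩` to `M ⊗ M`. -/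
def eval₂ : FreeAlgebra ℂ (Fin n) ⊗[ℂ] FreeAlgebra ℂ (Fin n) →ₐ[ℂ] W.M ⊗[ℂ] W.M :=
  Algebra.TensorProduct.map (W.eval X) (W.eval X)

/-- The algebra `ℂ⟨X₁,…,Xₙ⟩ ⊆ M` generated by `X₁,…,Xₙ`. -/
def polyAlg : Subalgebra ℂ W.M := (W.eval X).range

/-- The subspace `L²(X₁,…,Xₙ, τ)`, the closure of `ℂ⟨X₁,…,Xₙ⟩` in `L²(M, τ)`. -/
def L2gen : Set W.L2 := closure (W.toL2 '' (W.polyAlg X : Set W.M))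

/-- `(ξ₁,…,ξₙ)` is a conjugate system for `(X₁,…,Xₙ)`. -/
structure IsConjugateSystem (ξ : Fin n → W.L2) : Prop where
  conjugate_relations : ∀ (j : Fin n) (P : FreeAlgebra ℂ (Fin n)),
    W.ττ (W.eval₂ X (NCPoly.partialDeriv j P)) = W.τMul (ξ j) (W.eval X P)
  mem_L2gen : ∀ j, ξ j ∈ W.L2gen X

open Classical in
/-- The non-microstates free Fisher information `Φ*(X₁,…,Xₙ) ∈ [0, ∞]`. -/
def fisherInfo : ℝ≥0∞ :=
  if h : ∃ ξ : Fin n → W.L2, W.IsConjugateSystem X ξ then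
    ∑ j, ENNReal.ofReal (‖h.choose j‖ ^ 2)
  else ∞

/-- The inclusion of `ℂ⟨X⟩ ⊗ ℂ⟨X⟩` into `M ⊗ M`. -/
def inclTensor : W.polyAlg X ⊗[ℂ] W.polyAlg X →ₐ[ℂ] W.M ⊗[ℂ] W.M :=
  Algebra.TensorProduct.map (W.polyAlg X).val (W.polyAlg X).val

/-- The projective norm on `ℂ⟨X⟩ ⊗ ℂ⟨X⟩`: the infimum of `∑ₖ ‖Qₖ,₁‖ ‖Qₖ,₂‖` over all
decompositions `Q = ∑ₖ Qₖ,₁ ⊗ Qₖ,₂` with `Qₖ,₁, Qₖ,₂ ∈ ℂ⟨X⟩`. -/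
def projNorm (Q : W.polyAlg X ⊗[ℂ] W.polyAlg X) : ℝ :=
  sInf {r : ℝ | ∃ (N : ℕ) (q₁ q₂ : Fin N → W.polyAlg X),
    Q = ∑ k, q₁ k ⊗ₜ[ℂ] q₂ k ∧ r = ∑ k, ‖(q₁ k : W.M)‖ * ‖(q₂ k : W.M)‖}

theorem star_mem_polyAlg {X : Fin n → W.M} (hX : ∀ i, IsSelfAdjoint (X i)) {a : W.M}
    (ha : a ∈ W.polyAlg X) : star a ∈ W.polyAlg X := by
  obtain ⟨P, rfl⟩ := ha
  induction P using FreeAlgebra.induction with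
  | grade0 r =>
    change star (W.eval X _) ∈ _
    rw [AlgHom.commutes, ← algebraMap_star_comm]
    exact (W.polyAlg X).algebraMap_mem _
  | grade1 i =>
    have h : W.eval X (FreeAlgebra.ι ℂ i) = X i := by simp [eval]
    change star (W.eval X _) ∈ _
    rw [h, (hX i).star_eq, ← h]
    exact ⟨_, rfl⟩
  | mul P Q hP hQ =>
    change star (W.eval X _) ∈ _
    rw [map_mul, star_mul]
    exact mul_mem hQ hP
  | add P Q hP hQ =>
    change star (W.eval X _) ∈ _
    rw [map_add, star_add]
    exact add_mem hP hQ

/-- Conjugate systems are unique. -/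
theorem IsConjugateSystem.unique {ξ η : Fin n → W.L2} {X : Fin n → W.M}
    (hX : ∀ i, IsSelfAdjoint (X i)) (hξ : W.IsConjugateSystem X ξ)
    (hη : W.IsConjugateSystem X η) : ξ = η := by
  funext j
  have key : ∀ x ∈ W.L2gen X, inner ℂ x (ξ j) = inner ℂ x (η j) := by
    intro x hx
    refine closure_minimal (t := {x : W.L2 | inner ℂ x (ξ j) = inner ℂ x (η j)}) ?_ ?_ hx
    · rintro _ ⟨a, ha, rfl⟩
      obtain ⟨P, hP⟩ := W.star_mem_polyAlg hX ha
      have h := (hξ.conjugate_relations j P).symm.trans (hη.conjugate_relations j P)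
      have hP' : W.eval X P = star a := hP
      simpa [τMul, hP'] using h
    · exact isClosed_eq (by fun_prop) (by fun_prop)
  have h1 := key _ (hξ.mem_L2gen j)
  have h2 := key _ (hη.mem_L2gen j)
  rw [← sub_eq_zero, ← inner_self_eq_zero (𝕜 := ℂ)]
  simp only [inner_sub_left, inner_sub_right, h1, h2, sub_self]

/-- The free Fisher information does not depend on the choice made in its definition. -/
theorem IsConjugateSystem.fisherInfo_eq {ξ : Fin n → W.L2} {X : Fin n → W.M}
    (hX : ∀ i, IsSelfAdjoint (X i)) (hξ : W.IsConjugateSystem X ξ) :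
    W.fisherInfo X = ∑ j, ENNReal.ofReal (‖ξ j‖ ^ 2) := by
  have h : ∃ ξ : Fin n → W.L2, W.IsConjugateSystem X ξ := ⟨ξ, hξ⟩
  rw [fisherInfo, dif_pos h, h.choose_spec.unique W hX hξ]

end TracialWStarProbabilitySpace

end

/-! ### The transform x ↦ 2x(1 + x*x)⁻¹ in a C*-algebra -/

noncomputable section

namespace CStarAlgebra

variable {A : Type*} [CStarAlgebra A]

/-! By the Leibniz rule, (v*⊗1) ∂P (1⊗u) = ∂(v*P)(1⊗u) − ∂(v*)(1⊗Pu) for polynomial u, v. So ∂P is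
traded for derivatives in which P enters only through v*P and Pu, and it remains to bound τ⊗τ of
such terms by the 2-norms of these products (`norm_tr₂_right_le`, `norm_tr₂_left_le`).

Both bounds rest on Dabrowski's inequality `norm_adj_le`: the vector η(A) = ξA − (τ⊗id)(∂A)
satisfies ‖η(A)‖₂ ≤ ‖ξ‖₂‖A‖, hence ‖(τ⊗id)(∂A)‖₂ ≤ 2‖ξ‖₂‖A‖. Coassociativity of ∂ gives ‖η(A)‖₂² =
⟨ξ, η(AA*)⟩ up to conjugation (`norm_adj_sq_eq`). Cauchy–Schwarz, iterated along the powers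
(AA*)^(2^k), combined with the crude growth ‖η(C^m)‖₂ ≤ (‖ξ‖₂ + mβ) r^m for r ≥ ‖C‖, r > 0, forces
the sharp constant (`le_mul_of_sq_le_mul_succ`).

General u, v ∈ vN(X) are 2-norm limits of polynomials whose operator norms are asymptotically at
most ‖u‖, ‖v‖. This is Kaplansky's theorem, obtained from von Neumann's density theorem on an
amplification of H, from normality of τ, and from the map x ↦ 2x(1 + x*x)⁻¹, which sends everything
into the unit ball, covers the ball, and is Lipschitz for the 2-norm. The projective norm enters at
the end by summing over simple tensors. -/

theorem exists_star_mul_self_eq_norm_sq_sub (a : A) :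
    ∃ c : A, star c * c = algebraMap ℝ A (‖a‖ ^ 2) - a * star a := by
  let _ := CStarAlgebra.spectralOrder A
  have _ := CStarAlgebra.spectralOrderedRing A
  have h := sub_nonneg.2 (CStarAlgebra.mul_star_le_algebraMap_norm_sq (a := a))
  obtain ⟨c, hc⟩ := CStarAlgebra.nonneg_iff_eq_star_mul_self.1 h
  exact ⟨c, hc.symm⟩

theorem isUnit_one_add_star_mul_self (x : A) : IsUnit (1 + star x * x) := by
  let _ := CStarAlgebra.spectralOrder A
  have _ := CStarAlgebra.spectralOrderedRing A
  refine CStarAlgebra.isUnit_of_le 1 ?_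
  simp [star_mul_self_nonneg x]

/-- The element `(1 + x* x)⁻¹`. -/
def resolv (x : A) : A := Ring.inverse (1 + star x * x)

theorem mul_resolv (x : A) : (1 + star x * x) * resolv x = 1 :=
  Ring.mul_inverse_cancel _ (isUnit_one_add_star_mul_self x)

theorem resolv_mul (x : A) : resolv x * (1 + star x * x) = 1 :=
  Ring.inverse_mul_cancel _ (isUnit_one_add_star_mul_self x)

theorem resolv_eq_of_mul_eq_one {x c : A} (h : c * (1 + star x * x) = 1) : resolv x = c := by
  calc resolv x = c * (1 + star x * x) * resolv x := by rw [h, one_mul]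
    _ = c := by rw [mul_assoc, mul_resolv, mul_one]

theorem star_resolv (x : A) : star (resolv x) = resolv x := by
  refine (resolv_eq_of_mul_eq_one ?_).symm
  have := congrArg star (mul_resolv x)
  simpa using this

/-- Follows from x(1 + x*x) = (1 + xx*)x by inverting both outer factors. -/
theorem resolv_star_mul (x : A) : resolv (star x) * x = x * resolv x := by
  have h1 : x * (1 + star x * x) = (1 + star (star x) * star x) * x := by
    simp [mul_add, add_mul, mul_assoc]
  calc resolv (star x) * x = resolv (star x) * (x * (1 + star x * x)) * resolv x := by
        rw [mul_assoc, mul_assoc, mul_resolv, mul_one]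
    _ = x * resolv x := by rw [h1, ← mul_assoc, resolv_mul, one_mul]

theorem norm_le_one_of_star_mul_self_add {b c : A} (h : star b * b + star c * c = 1) :
    ‖b‖ ≤ 1 := by
  let _ := CStarAlgebra.spectralOrder A
  have _ := CStarAlgebra.spectralOrderedRing A
  have h1 : star b * b ≤ 1 := by
    rw [← h]
    exact le_add_of_nonneg_right (star_mul_self_nonneg c)
  have h2 : ‖star b * b‖ ≤ 1 :=
    (CStarAlgebra.norm_le_one_iff_of_nonneg _ (star_mul_self_nonneg b)).2 h1
  rw [CStarRing.norm_star_mul_self] at h2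
  nlinarith [norm_nonneg b]

/-- A noncommutative form of (2t)² + (1 − t²)² = (1 + t²)²: with r = (1 + x*x)⁻¹, the elements b =
2xr and c = (1 − x*x)r satisfy b*b + c*c = 1. -/
theorem norm_two_mul_resolv_le (x : A) : ‖(2 : ℂ) • (x * resolv x)‖ ≤ 1 := by
  refine norm_le_one_of_star_mul_self_add (c := (1 - star x * x) * resolv x) ?_
  have h1 := mul_resolv x
  have h2 := resolv_mul x
  simp only [star_smul, star_mul, star_sub, star_one, star_star, star_resolv]
  set r := resolv x
  set w := star x * x
  have e1 : w * r = 1 - r := by rw [eq_sub_iff_add_eq, add_comm, ← h1]; noncomm_ring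
  have e2 : r * w = 1 - r := by rw [eq_sub_iff_add_eq, add_comm, ← h2]; noncomm_ring
  have e3 : r * star x * (x * r) = (1 - r) * r := by
    rw [← e2]; simp only [w, mul_assoc]
  have e4 : (1 - w) * r = 2 • r - 1 := by
    rw [sub_mul, e1, one_mul, two_smul]; abel
  have e5 : r * (1 - w) = 2 • r - 1 := by
    rw [mul_sub, e2, mul_one, two_smul]; abel
  have hstar : star (2 : ℂ) = 2 := by simp
  rw [hstar, smul_mul_smul_comm, e3, e4, e5]
  have : (2 * 2 : ℂ) • ((1 - r) * r) = 4 • ((1 - r) * r) := by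
    rw [← Nat.cast_smul_eq_nsmul ℂ]; norm_num
  rw [this]
  noncomm_ring

theorem norm_mul_resolv_le (x : A) : ‖x * resolv x‖ ≤ 1 / 2 := by
  have := norm_two_mul_resolv_le x
  rw [norm_smul] at this
  norm_num at this
  linarith

theorem norm_resolv_le (x : A) : ‖resolv x‖ ≤ 1 := by
  let _ := CStarAlgebra.spectralOrder A
  have _ := CStarAlgebra.spectralOrderedRing A
  obtain ⟨u, hu⟩ := isUnit_one_add_star_mul_self x
  have h1 : (1 : A) ≤ u := by
    rw [hu]
    simp [star_mul_self_nonneg x]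
  have h2 : resolv x = ↑u⁻¹ := by rw [resolv, ← hu, Ring.inverse_unit]
  have h3 := CStarAlgebra.inv_le_one (show (1 : Aˣ) ≤ u from h1)
  rw [← h2] at h3
  -- With r the resolvent, r = r(1 + x*x)r = r*r + (xr)*(xr).
  have h4 : 0 ≤ resolv x := by
    have : resolv x = star (resolv x) * resolv x + star (x * resolv x) * (x * resolv x) := by
      rw [star_mul, star_resolv]
      calc resolv x = resolv x * ((1 + star x * x) * resolv x) := by rw [mul_resolv, mul_one]
        _ = _ := by noncomm_ring
    rw [this]
    exact add_nonneg (star_mul_self_nonneg _) (star_mul_self_nonneg _)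
  exact (CStarAlgebra.norm_le_one_iff_of_nonneg _ h4).2 h3

/-- Solving 2t/(1 + t²) = u for scalars gives t = u/(1 + √(1 − u²)); here y = u(1 + s)⁻¹ with s =
√(1 − u*u), and then 1 + y*y = 2(1 + s)⁻¹. -/
theorem exists_two_mul_resolv_eq (u : A) (hu : ‖u‖ ≤ 1) :
    ∃ y : A, (2 : ℂ) • (y * resolv y) = u := by
  let _ := CStarAlgebra.spectralOrder A
  have _ := CStarAlgebra.spectralOrderedRing A
  have h0 : 0 ≤ 1 - star u * u := by
    rw [sub_nonneg]
    refine (CStarAlgebra.norm_le_one_iff_of_nonneg _ (star_mul_self_nonneg u)).1 ?_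
    rw [CStarRing.norm_star_mul_self]
    nlinarith [norm_nonneg u]
  set s := CFC.sqrt (1 - star u * u) with hs
  have hs0 : 0 ≤ s := CFC.sqrt_nonneg _
  have hss : s * s = 1 - star u * u := CFC.sqrt_mul_sqrt_self _ h0
  have hsa : star s = s := (IsSelfAdjoint.of_nonneg hs0).star_eq
  obtain ⟨w, hw⟩ := CStarAlgebra.isUnit_of_le (b := 1 + s) 1 (by simpa using hs0)
  set c : A := ↑w⁻¹
  have hc1 : (1 + s) * c = 1 := by rw [← hw]; exact w.mul_inv
  have hc2 : c * (1 + s) = 1 := by rw [← hw]; exact w.inv_mul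
  have hcs : star c = c := by
    have h := congrArg star hc1
    simp only [star_mul, star_add, star_one, hsa] at h
    calc star c = star c * ((1 + s) * c) := by rw [hc1, mul_one]
      _ = c := by rw [← mul_assoc, h, one_mul]
  refine ⟨u * c, ?_⟩
  have huu : star u * u = (1 + s) * (1 - s) := by
    have : star u * u = 1 - s * s := by rw [hss]; abel
    rw [this]; noncomm_ring
  have hy : 1 + star (u * c) * (u * c) = (2 : ℂ) • c := by
    rw [star_mul, hcs]
    calc 1 + c * star u * (u * c) = 1 + c * (star u * u) * c := by simp only [mul_assoc]
      _ = 1 + (1 - s) * c := by rw [huu, ← mul_assoc, hc2, one_mul]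
      _ = (1 + s) * c + (1 - s) * c := by rw [hc1]
      _ = (2 : ℂ) • c := by rw [two_smul]; noncomm_ring
  have hr : resolv (u * c) = (1 / 2 : ℂ) • (1 + s) := by
    refine resolv_eq_of_mul_eq_one ?_
    rw [hy, smul_mul_smul_comm, hc1]
    norm_num
  rw [hr, mul_smul_comm, smul_smul, mul_assoc, hc2]
  norm_num

theorem resolv_mem (S : StarSubalgebra ℂ A) (hS : IsClosed (S : Set A)) {x : A} (hx : x ∈ S) :
    resolv x ∈ S := by
  -- A closed *-subalgebra is itself a C*-algebra, so the inverse can be formed inside it;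
  -- uniqueness of inverses identifies it with the one in the ambient algebra.
  have _ := hS
  let x' : S := ⟨x, hx⟩
  have h : ((resolv x' : S) : A) * (1 + star x * x) = 1 := congrArg Subtype.val (resolv_mul x')
  rw [resolv_eq_of_mul_eq_one h]
  exact (resolv x').2

theorem exists_mem_two_mul_resolv_eq (S : StarSubalgebra ℂ A) (hS : IsClosed (S : Set A)) {u : A}
    (hu : u ∈ S) (hu1 : ‖u‖ ≤ 1) : ∃ y ∈ S, (2 : ℂ) • (y * resolv y) = u := by
  have _ := hS
  obtain ⟨y, hy⟩ := exists_two_mul_resolv_eq (⟨u, hu⟩ : S) hu1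
  have h : ((resolv y : S) : A) * (1 + star (y : A) * y) = 1 :=
    congrArg Subtype.val (resolv_mul y)
  refine ⟨y, y.2, ?_⟩
  rw [resolv_eq_of_mul_eq_one h]
  exact congrArg Subtype.val hy

/-- A resolvent identity: each summand contains x − y or (y − x)* between factors of bounded
operator norm, which is what a Lipschitz estimate in the 2-norm needs. -/
theorem resolv_sub_resolv (x y : A) :
    x * resolv x - y * resolv y =
      resolv (star x) * (x - y) * resolv y + (x * resolv x) * star (y - x) * (y * resolv y) := by
  rw [← resolv_star_mul x]
  have h1 := resolv_mul (star x)
  have h2 := mul_resolv y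
  rw [star_star] at h1
  calc resolv (star x) * x - y * resolv y
      = resolv (star x) * x * ((1 + star y * y) * resolv y)
        - (resolv (star x) * (1 + x * star x)) * y * resolv y := by rw [h1, h2, mul_one, one_mul]
    _ = _ := by rw [star_sub]; noncomm_ring

end CStarAlgebra
end

/-! ### Amplifications and von Neumann's density theorem -/

noncomputable section

section Amplification

variable {H : Type*} [NormedAddCommGroup H] [InnerProductSpace ℂ H] {ι : Type*}

theorem ContinuousLinearMap.memℓp_two_comp (a : H →L[ℂ] H) {f : ι → H} (hf : Memℓp f 2) :
    Memℓp (fun i => a (f i)) 2 := by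
  have h2 : 0 < (2 : ℝ≥0∞).toReal := by norm_num
  rw [memℓp_gen_iff h2] at hf ⊢
  simp only [ENNReal.toReal_ofNat, Real.rpow_ofNat] at hf ⊢
  refine Summable.of_nonneg_of_le (fun i => by positivity) (fun i => ?_) (hf.mul_left (‖a‖ ^ 2))
  rw [← mul_pow]
  gcongr
  exact a.le_opNorm _

/-- The diagonal action of `a` on `⨁ᵢ H`. -/
def ContinuousLinearMap.amplify (ι : Type*) (a : H →L[ℂ] H) :
    lp (fun _ : ι => H) 2 →L[ℂ] lp (fun _ : ι => H) 2 :=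
  LinearMap.mkContinuous
    { toFun f := ⟨fun i => a (f i), a.memℓp_two_comp f.2⟩
      map_add' f g := by ext i; simp; rfl
      map_smul' c f := by ext i; simp } ‖a‖ (by
    intro f
    have h2 : 0 < (2 : ℝ≥0∞).toReal := by norm_num
    refine lp.norm_le_of_tsum_le h2 (by positivity) ?_
    have h := lp.norm_rpow_eq_tsum h2 f
    have hs := (memℓp_gen_iff h2).1 f.2
    have hs' := (memℓp_gen_iff h2).1 (a.memℓp_two_comp f.2)
    simp only [ENNReal.toReal_ofNat, Real.rpow_ofNat] at h hs hs' ⊢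
    rw [mul_pow, h, ← tsum_mul_left]
    refine hs'.tsum_le_tsum (fun i => ?_) (hs.mul_left _)
    rw [← mul_pow]
    gcongr
    exact a.le_opNorm _)

theorem ContinuousLinearMap.amplify_apply (a : H →L[ℂ] H) (f : lp (fun _ : ι => H) 2) (i : ι) :
    a.amplify ι f i = a (f i) := rfl

theorem ContinuousLinearMap.amplify_single [DecidableEq ι] (a : H →L[ℂ] H) (i : ι) (x : H) :
    a.amplify ι (lp.single 2 i x) = lp.single 2 i (a x) := by
  ext j
  rw [ContinuousLinearMap.amplify_apply]
  by_cases h : j = i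
  · subst h; simp
  · simp [h]

theorem ContinuousLinearMap.inner_amplify [CompleteSpace H] (a : H →L[ℂ] H)
    (f g : lp (fun _ : ι => H) 2) :
    inner ℂ f (a.amplify ι g) = inner ℂ ((star a).amplify ι f) g := by
  rw [lp.inner_eq_tsum, lp.inner_eq_tsum]
  refine tsum_congr fun i => ?_
  simp only [ContinuousLinearMap.amplify_apply]
  rw [ContinuousLinearMap.star_eq_adjoint, ContinuousLinearMap.adjoint_inner_left]

/-- The density theorem of von Neumann. -/
theorem StarSubalgebra.amplify_mem_closure [CompleteSpace H] (S : StarSubalgebra ℂ (H →L[ℂ] H))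
    {u : H →L[ℂ] H} (hu : ∀ g : H →L[ℂ] H, (∀ a ∈ S, a * g = g * a) → g * u = u * g)
    (ζ : lp (fun _ : ι => H) 2) :
    u.amplify ι ζ ∈ closure ((fun a : H →L[ℂ] H => a.amplify ι ζ) '' (S : Set (H →L[ℂ] H))) := by
  classical
  let N₀ : Submodule ℂ (lp (fun _ : ι => H) 2) :=
    { carrier := (fun a : H →L[ℂ] H => a.amplify ι ζ) '' (S : Set (H →L[ℂ] H))
      add_mem' := by
        rintro _ _ ⟨a, ha, rfl⟩ ⟨b, hb, rfl⟩
        exact ⟨a + b, add_mem ha hb, by ext i; simp [ContinuousLinearMap.amplify_apply]⟩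
      zero_mem' := ⟨0, zero_mem S, by ext i; simp [ContinuousLinearMap.amplify_apply]⟩
      smul_mem' := by
        rintro c _ ⟨a, ha, rfl⟩
        exact ⟨c • a, SMulMemClass.smul_mem c ha, by
          ext i; simp [ContinuousLinearMap.amplify_apply]⟩ }
  let N := N₀.topologicalClosure
  have hinv : ∀ a ∈ S, ∀ x ∈ N, a.amplify ι x ∈ N := by
    intro a ha x hx
    refine map_mem_closure (a.amplify ι).continuous hx ?_
    rintro _ ⟨b, hb, rfl⟩
    exact ⟨a * b, mul_mem ha hb, by ext i; simp [ContinuousLinearMap.amplify_apply]⟩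
  have : CompleteSpace N := N₀.isClosed_topologicalClosure.completeSpace_coe
  let p := N.starProjection
  have hpN : ∀ x, p x ∈ N := fun x => N.starProjection_apply_mem x
  -- The closed orbit N is invariant under S = S*, so its orthogonal complement is too.
  have hcomm : ∀ a ∈ S, ∀ x, p (a.amplify ι x) = a.amplify ι (p x) := by
    intro a ha x
    refine Submodule.eq_starProjection_of_mem_orthogonal (hinv a ha _ (hpN x)) ?_ |>.symm ▸ rfl
    rw [Submodule.mem_orthogonal]
    intro y hy
    rw [← map_sub, ContinuousLinearMap.inner_amplify]
    exact (Submodule.mem_orthogonal _ _).1 (N.sub_starProjection_mem_orthogonal x) _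
      (hinv _ (star_mem ha) y hy)
  -- The matrix entries of the projection p lie in the commutant of S. Hence u commutes with each of
  -- them, its amplification commutes with p, and N is invariant under u.
  let e (i j : ι) : H →L[ℂ] H :=
    (lp.evalCLM ℂ (fun _ : ι => H) 2 i).comp
      (p.comp (lp.singleContinuousLinearMap ℂ (fun _ : ι => H) 2 j))
  have he : ∀ i j x, e i j x = p (lp.single 2 j x) i := fun i j x => rfl
  have hue : ∀ i j x, e i j (u x) = u (e i j x) := by
    intro i j x
    have := hu (e i j) fun a ha => by
      ext x
      rw [mul_apply_eq_comp, mul_apply_eq_comp, he, he,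
        ← ContinuousLinearMap.amplify_single, hcomm a ha, ContinuousLinearMap.amplify_apply]
    exact DFunLike.congr_fun this x
  have hup : p.comp (u.amplify ι) = (u.amplify ι).comp p := by
    refine lp.ext_continuousLinearMap (by norm_num) fun j => ?_
    ext x i
    have h := hue i j x
    rw [he, he] at h
    change p (u.amplify ι (lp.single 2 j x)) i = u.amplify ι (p (lp.single 2 j x)) i
    rw [ContinuousLinearMap.amplify_single, h, ContinuousLinearMap.amplify_apply]
  have hζ : ζ ∈ N := N₀.le_topologicalClosure
    ⟨1, one_mem S, by ext i; simp [ContinuousLinearMap.amplify_apply]⟩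
  have h1 := DFunLike.congr_fun hup ζ
  rw [ContinuousLinearMap.comp_apply, ContinuousLinearMap.comp_apply,
    (N.starProjection_eq_self_iff).2 hζ] at h1
  have h2 := hpN (u.amplify ι ζ)
  rw [h1] at h2
  exact h2

end Amplification

section Normal

variable {H : Type*} [NormedAddCommGroup H] [InnerProductSpace ℂ H]

theorem StarSubalgebra.exists_tsum_norm_sq_lt [CompleteSpace H] {ι : Type*}
    (S : StarSubalgebra ℂ (H →L[ℂ] H))
    {u : H →L[ℂ] H} (hu : ∀ g : H →L[ℂ] H, (∀ a ∈ S, a * g = g * a) → g * u = u * g)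
    {ζ : ι → H} (hζ : Summable fun i => ‖ζ i‖ ^ 2) {ε : ℝ} (hε : 0 < ε) :
    ∃ a ∈ S, (Summable fun i => ‖(a - u) (ζ i)‖ ^ 2) ∧ ∑' i, ‖(a - u) (ζ i)‖ ^ 2 < ε := by
  have h2 : 0 < (2 : ℝ≥0∞).toReal := by norm_num
  let z : lp (fun _ : ι => H) 2 := ⟨ζ, (memℓp_gen_iff h2).2 (by simpa using hζ)⟩
  obtain ⟨_, ⟨a, ha, rfl⟩, h⟩ :=
    Metric.mem_closure_iff.1 (S.amplify_mem_closure hu z) (√ε) (Real.sqrt_pos.2 hε)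
  have hd : a.amplify ι z - u.amplify ι z = (a - u).amplify ι z := by
    ext i; simp [ContinuousLinearMap.amplify_apply]
  rw [dist_comm, dist_eq_norm, hd, Real.lt_sqrt (norm_nonneg _)] at h
  have h1 := lp.norm_rpow_eq_tsum h2 ((a - u).amplify ι z)
  have h3 := (memℓp_gen_iff h2).1 ((a - u).amplify ι z).2
  simp only [ENNReal.toReal_ofNat, Real.rpow_ofNat] at h1 h3
  rw [h1] at h
  exact ⟨a, ha, h3, h⟩

end Normal
end

/-! ### Inequalities for the 2-norm and right multiplication on L² -/

noncomputable section

namespace TracialWStarProbabilitySpace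

variable {H : Type*} [NormedAddCommGroup H] [InnerProductSpace ℂ H] [CompleteSpace H]
  (W : TracialWStarProbabilitySpace H)

theorem isClosed_vna : IsClosed (W.vna.toStarSubalgebra : Set (H →L[ℂ] H)) := by
  rw [VonNeumannAlgebra.coe_toStarSubalgebra, ← W.vna.centralizer_centralizer]
  exact Set.isClosed_centralizer _

attribute [local instance] isClosed_vna

theorem toL2_add (a b : W.M) : W.toL2 (a + b) = W.toL2 a + W.toL2 b := by
  simp only [toL2, map_add, UniformSpace.Completion.coe_add]

theorem toL2_smul (c : ℂ) (a : W.M) : W.toL2 (c • a) = c • W.toL2 a := by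
  simp only [toL2, map_smul, UniformSpace.Completion.coe_smul]

theorem toL2_zero : W.toL2 0 = 0 := by
  simp only [toL2, map_zero, UniformSpace.Completion.coe_zero]

theorem toL2_sub (a b : W.M) : W.toL2 (a - b) = W.toL2 a - W.toL2 b := by
  simp only [toL2, map_sub, UniformSpace.Completion.coe_sub]

theorem norm2_nonneg (a : W.M) : 0 ≤ W.norm2 a := norm_nonneg _

theorem norm2_add_le (a b : W.M) : W.norm2 (a + b) ≤ W.norm2 a + W.norm2 b := by
  rw [norm2, toL2_add]
  exact norm_add_le _ _

theorem norm2_smul (c : ℂ) (a : W.M) : W.norm2 (c • a) = ‖c‖ * W.norm2 a := by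
  rw [norm2, toL2_smul, norm_smul, norm2]

theorem norm2_star (a : W.M) : W.norm2 (star a) = W.norm2 a := by
  have h : ((W.norm2 (star a) ^ 2 : ℝ) : ℂ) = ((W.norm2 a ^ 2 : ℝ) : ℂ) := by
    rw [norm2_sq, norm2_sq, star_star, W.τ_tracial]
  exact (pow_left_inj₀ (W.norm2_nonneg _) (W.norm2_nonneg _) two_ne_zero).1 (by exact_mod_cast h)

/-- Traciality turns ‖ba‖₂² into τ(b aa* b*), and ‖a‖² − aa* = c*c makes τ(b(‖a‖² − aa*)b*)
nonnegative. -/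
theorem norm2_mul_le (b a : W.M) : W.norm2 (b * a) ≤ W.norm2 b * ‖a‖ := by
  refine (pow_le_pow_iff_left₀ (W.norm2_nonneg _)
    (mul_nonneg (W.norm2_nonneg _) (norm_nonneg _)) two_ne_zero).1 ?_
  obtain ⟨c, hc⟩ := CStarAlgebra.exists_star_mul_self_eq_norm_sq_sub a
  have h1 := W.τ_nonneg (c * star b)
  have h2 : star (c * star b) * (c * star b) =
      ((‖a‖ ^ 2 : ℝ) : ℂ) • (b * star b) - b * a * star (b * a) := by
    have h3 : algebraMap ℝ W.M (‖a‖ ^ 2) = ((‖a‖ ^ 2 : ℝ) : ℂ) • (1 : W.M) := by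
      rw [Algebra.algebraMap_eq_smul_one]; rfl
    rw [star_mul, star_star, star_mul]
    calc b * star c * (c * star b) = b * (star c * c) * star b := by noncomm_ring
      _ = _ := by
        rw [hc, h3, mul_sub, sub_mul, mul_smul_comm, smul_mul_assoc, mul_one]
        noncomm_ring
  rw [h2, map_sub, map_smul, W.τ_tracial b, W.τ_tracial (b * a), ← norm2_sq, ← norm2_sq,
    smul_eq_mul, sub_nonneg, ← Complex.ofReal_mul] at h1
  rw [mul_pow, mul_comm]
  exact_mod_cast h1

theorem norm2_mul_le' (a b : W.M) : W.norm2 (a * b) ≤ ‖a‖ * W.norm2 b := by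
  rw [← norm2_star, star_mul, mul_comm ‖a‖, ← W.norm2_star b, ← norm_star a]
  exact W.norm2_mul_le _ _

theorem norm_τ_mul_le (a b : W.M) : ‖W.τ (a * b)‖ ≤ W.norm2 a * W.norm2 b := by
  have h := norm_inner_le_norm (𝕜 := ℂ) (W.toL2 (star a)) (W.toL2 b)
  rw [inner_toL2, star_star] at h
  rwa [← W.norm2_star a]

theorem norm2_le_norm (a : W.M) : W.norm2 a ≤ ‖a‖ := by
  have h1 : W.norm2 1 = 1 := by
    have h := W.norm2_sq 1
    rw [star_one, mul_one, W.τ_one] at h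
    have h' : W.norm2 1 ^ 2 = 1 := by exact_mod_cast h
    exact (pow_eq_one_iff_of_nonneg (W.norm2_nonneg _) two_ne_zero).1 h'
  simpa [h1] using W.norm2_mul_le 1 a

/-- Right multiplication by `a` on `L²(M, τ)`. -/
def rmul (a : W.M) : W.L2 →L[ℂ] W.L2 :=
  ContinuousLinearMap.extend
    (UniformSpace.Completion.toComplL.comp
      (LinearMap.mkContinuous (W.toPreL2.toLinearMap ∘ₗ LinearMap.mulRight ℂ a ∘ₗ
        W.toPreL2.symm.toLinearMap) ‖a‖ (by
        intro x
        have h := W.norm2_mul_le (W.toPreL2.symm x) a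
        rw [norm2, norm2, toL2, toL2, UniformSpace.Completion.norm_coe,
          UniformSpace.Completion.norm_coe, mul_comm] at h
        simpa using h) : W.PreL2 →L[ℂ] W.PreL2))
    UniformSpace.Completion.toComplL

theorem denseRange_toL2 : DenseRange W.toL2 := by
  have h := (UniformSpace.Completion.denseRange_coe (α := W.PreL2)).comp
    W.toPreL2.surjective.denseRange (UniformSpace.Completion.continuous_coe _)
  exact h

theorem rmul_toL2 (a b : W.M) : W.rmul a (W.toL2 b) = W.toL2 (b * a) := by
  have h := ContinuousLinearMap.extend_eq
    (UniformSpace.Completion.toComplL.comp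
      (LinearMap.mkContinuous (W.toPreL2.toLinearMap ∘ₗ LinearMap.mulRight ℂ a ∘ₗ
        W.toPreL2.symm.toLinearMap) ‖a‖ (by
        intro x
        have h := W.norm2_mul_le (W.toPreL2.symm x) a
        rw [norm2, norm2, toL2, toL2, UniformSpace.Completion.norm_coe,
          UniformSpace.Completion.norm_coe, mul_comm] at h
        simpa using h) : W.PreL2 →L[ℂ] W.PreL2))
    (e := UniformSpace.Completion.toComplL (𝕜 := ℂ) (E := W.PreL2))
    (UniformSpace.Completion.denseRange_coe)
    (UniformSpace.Completion.isUniformInducing_coe _) (W.toPreL2 b)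
  simpa [toL2, rmul] using h

theorem norm_rmul_apply_le (a : W.M) (x : W.L2) : ‖W.rmul a x‖ ≤ ‖a‖ * ‖x‖ := by
  refine W.denseRange_toL2.induction_on (p := fun x => ‖W.rmul a x‖ ≤ ‖a‖ * ‖x‖) x
    (isClosed_le (by fun_prop) (by fun_prop)) fun b => ?_
  rw [rmul_toL2, mul_comm]
  exact W.norm2_mul_le b a

theorem inner_rmul (a : W.M) (x y : W.L2) :
    inner ℂ (W.rmul a x) y = inner ℂ x (W.rmul (star a) y) := by
  refine W.denseRange_toL2.induction_on
    (p := fun x => inner ℂ (W.rmul a x) y = inner ℂ x (W.rmul (star a) y)) x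
    (isClosed_eq (by fun_prop) (by fun_prop)) fun b => ?_
  refine W.denseRange_toL2.induction_on
    (p := fun y => inner ℂ (W.rmul a (W.toL2 b)) y = inner ℂ (W.toL2 b) (W.rmul (star a) y)) y
    (isClosed_eq (by fun_prop) (by fun_prop)) fun c => ?_
  rw [rmul_toL2, rmul_toL2, inner_toL2, inner_toL2, star_mul, mul_assoc, W.τ_tracial, mul_assoc]

theorem τMul_rmul (a b : W.M) (x : W.L2) : W.τMul (W.rmul a x) b = W.τMul x (a * b) := by
  have h := congrArg star (W.inner_rmul a x (W.toL2 (star b)))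
  rw [rmul_toL2, ← star_mul] at h
  rwa [← starRingEnd_apply, ← starRingEnd_apply, inner_conj_symm, inner_conj_symm] at h

theorem norm_τMul_le (x : W.L2) (a : W.M) : ‖W.τMul x a‖ ≤ ‖x‖ * W.norm2 a := by
  rw [← W.norm2_star, mul_comm]
  exact norm_inner_le_norm _ _

end TracialWStarProbabilitySpace
end

/-! ### Normality of the trace and Kaplansky's theorem in the 2-norm -/

noncomputable section

section Normal

variable {H : Type*} [NormedAddCommGroup H] [InnerProductSpace ℂ H]

theorem ContinuousLinearMap.summable_norm_sq_apply {ι : Type*} (x : H →L[ℂ] H) {z : ι → H}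
    (hz : Summable fun k => ‖z k‖ ^ 2) : Summable fun k => ‖x (z k)‖ ^ 2 := by
  refine Summable.of_nonneg_of_le (fun i => by positivity) (fun i => ?_) (hz.mul_left (‖x‖ ^ 2))
  rw [← mul_pow]
  gcongr
  exact x.le_opNorm _

theorem norm_inner_le_norm_sq_add (x y : H) : ‖inner ℂ x y‖ ≤ ‖x‖ ^ 2 + ‖y‖ ^ 2 := by
  refine (norm_inner_le_norm x y).trans ?_
  nlinarith [sq_nonneg (‖x‖ - ‖y‖), sq_nonneg (‖x‖ + ‖y‖)]

theorem summable_inner_of_summable_norm_sq {ι : Type*} {y z : ι → H}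
    (hy : Summable fun k => ‖y k‖ ^ 2) (hz : Summable fun k => ‖z k‖ ^ 2) :
    Summable fun k => inner ℂ (y k) (z k) :=
  Summable.of_norm_bounded (hy.add hz) fun _ => norm_inner_le_norm_sq_add _ _

variable (H) in
/-- The pairs of square summable sequences in `H`. -/
abbrev SqSummablePair : Type _ :=
  {p : (ℕ → H) × (ℕ → H) // (Summable fun k => ‖p.1 k‖ ^ 2) ∧ Summable fun k => ‖p.2 k‖ ^ 2}

/-- The vector functional `x ↦ ∑ₖ ⟪ηₖ, x ζₖ⟫`. -/
def SqSummablePair.functional (p : SqSummablePair H) : (H →L[ℂ] H) →ₗ[ℂ] ℂ where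
  toFun x := ∑' k, inner ℂ (p.1.1 k) (x (p.1.2 k))
  map_add' x y := by
    have h (x : H →L[ℂ] H) :=
      summable_inner_of_summable_norm_sq p.2.1 (x.summable_norm_sq_apply p.2.2)
    rw [← (h x).tsum_add (h y)]
    simp
  map_smul' c x := by
    simp [tsum_mul_left]

theorem SqSummablePair.norm_functional_star_mul_self_le [CompleteSpace H] (p : SqSummablePair H) (x : H →L[ℂ] H) :
    ‖p.functional (star x * x)‖ ≤ ∑' k, ‖x (p.1.1 k)‖ ^ 2 + ∑' k, ‖x (p.1.2 k)‖ ^ 2 := by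
  have h1 := x.summable_norm_sq_apply p.2.1
  have h2 := x.summable_norm_sq_apply p.2.2
  have h3 : p.functional (star x * x) = ∑' k, inner ℂ (x (p.1.1 k)) (x (p.1.2 k)) := by
    refine tsum_congr fun k => ?_
    rw [mul_apply_eq_comp, ContinuousLinearMap.star_eq_adjoint,
      ContinuousLinearMap.adjoint_inner_right]
  rw [h3, ← h1.tsum_add h2]
  exact tsum_of_norm_bounded (h1.add h2).hasSum fun _ => norm_inner_le_norm_sq_add _ _

end Normal

namespace TracialWStarProbabilitySpace

attribute [local instance] isClosed_vna

variable {H : Type*} [NormedAddCommGroup H] [InnerProductSpace ℂ H] [CompleteSpace H]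
  (W : TracialWStarProbabilitySpace H)

/-- A linear functional continuous for the coarsest topology making a family of functionals
continuous is a finite linear combination of the family. -/
theorem τ_mem_span : W.τ ∈ Submodule.span ℂ (Set.range fun p : SqSummablePair H =>
    p.functional ∘ₗ W.vna.toStarSubalgebra.subtype.toLinearMap) := by
  rw [LinearMap.mem_span_iff_continuous]
  have h := W.τ_normal
  rw [ultraweakTopology, induced_iInf] at h
  convert h using 2
  funext p
  exact (induced_compose (f := (Subtype.val : W.M → H →L[ℂ] H)) (g := p.functional)).symm

/-- This controls the 2-norm by the norm of one vector in a direct sum of copies of H, where the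
density theorem applies. Sums of functionals are handled by disjoint unions of index sets. -/
theorem exists_norm_τ_star_mul_self_le : ∃ (ι : Type) (z : ι → H) (C : ℝ), 0 ≤ C ∧
    (Summable fun k => ‖z k‖ ^ 2) ∧
    ∀ x : W.M, ‖W.τ (star x * x)‖ ≤ C * ∑' k, ‖(x : H →L[ℂ] H) (z k)‖ ^ 2 := by
  refine Submodule.span_induction (p := fun (φ : W.M →ₗ[ℂ] ℂ) _ =>
    ∃ (ι : Type) (z : ι → H) (C : ℝ), 0 ≤ C ∧ (Summable fun k => ‖z k‖ ^ 2) ∧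
    ∀ x : W.M, ‖φ (star x * x)‖ ≤ C * ∑' k, ‖(x : H →L[ℂ] H) (z k)‖ ^ 2) ?_ ?_ ?_ ?_ W.τ_mem_span
  · rintro _ ⟨p, rfl⟩
    refine ⟨ℕ ⊕ ℕ, Sum.elim p.1.1 p.1.2, 1, zero_le_one, ?_, fun x => ?_⟩
    · exact (HasSum.sum (f := fun k => ‖Sum.elim p.1.1 p.1.2 k‖ ^ 2)
        p.2.1.hasSum p.2.2.hasSum).summable
    · have h1 := (x : H →L[ℂ] H).summable_norm_sq_apply p.2.1
      have h2 := (x : H →L[ℂ] H).summable_norm_sq_apply p.2.2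
      have h3 := (HasSum.sum (f := fun k => ‖(x : H →L[ℂ] H) (Sum.elim p.1.1 p.1.2 k)‖ ^ 2)
        h1.hasSum h2.hasSum).tsum_eq
      rw [one_mul, h3]
      exact p.norm_functional_star_mul_self_le x
  · exact ⟨ℕ, 0, 0, le_rfl, by simp, by simp⟩
  · rintro φ ψ - - ⟨ι, z, C, hC, hz, h⟩ ⟨κ, y, D, hD, hy, h'⟩
    refine ⟨ι ⊕ κ, Sum.elim z y, C + D, add_nonneg hC hD, ?_, fun x => ?_⟩
    · exact (HasSum.sum (f := fun k => ‖Sum.elim z y k‖ ^ 2) hz.hasSum hy.hasSum).summable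
    · have h1 := (x : H →L[ℂ] H).summable_norm_sq_apply hz
      have h2 := (x : H →L[ℂ] H).summable_norm_sq_apply hy
      have h3 := (HasSum.sum (f := fun k => ‖(x : H →L[ℂ] H) (Sum.elim z y k)‖ ^ 2)
        h1.hasSum h2.hasSum).tsum_eq
      rw [h3]
      have e1 : 0 ≤ ∑' k, ‖(x : H →L[ℂ] H) (z k)‖ ^ 2 := tsum_nonneg fun _ => by positivity
      have e2 : 0 ≤ ∑' k, ‖(x : H →L[ℂ] H) (y k)‖ ^ 2 := tsum_nonneg fun _ => by positivity
      refine (norm_add_le (φ (star x * x)) (ψ (star x * x))).trans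
        ((add_le_add (h x) (h' x)).trans ?_)
      nlinarith [mul_nonneg hC e2, mul_nonneg hD e1]
  · rintro c φ - ⟨ι, z, C, hC, hz, h⟩
    refine ⟨ι, z, ‖c‖ * C, by positivity, hz, fun x => ?_⟩
    rw [LinearMap.smul_apply, norm_smul, mul_assoc]
    exact mul_le_mul_of_nonneg_left (h x) (norm_nonneg c)

/-- Commutation with the commutant of `S` in `B(H)`. -/
def IsInBicommutant (S : StarSubalgebra ℂ W.M) (u : W.M) : Prop :=
  ∀ g : H →L[ℂ] H, (∀ a ∈ S, (a : H →L[ℂ] H) * g = g * a) → g * (u : H →L[ℂ] H) = u * g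

theorem exists_mem_norm2_sub_lt {S : StarSubalgebra ℂ W.M} {u : W.M}
    (hu : W.IsInBicommutant S u) {ε : ℝ} (hε : 0 < ε) : ∃ a ∈ S, W.norm2 (a - u) < ε := by
  obtain ⟨ι, z, C, hC, hz, h⟩ := W.exists_norm_τ_star_mul_self_le
  -- The summand 1 allows for C = 0.
  have hδ : 0 < ε ^ 2 / (C + 1) := by positivity
  obtain ⟨_, ⟨a, ha, rfl⟩, -, h2⟩ :=
    (S.map W.vna.toStarSubalgebra.subtype).exists_tsum_norm_sq_lt
      (u := (u : H →L[ℂ] H)) (fun g hg => hu g fun a ha => hg _ ⟨a, ha, rfl⟩) hz hδ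
  refine ⟨a, ha, ?_⟩
  refine lt_of_pow_lt_pow_left₀ 2 hε.le ?_
  have h3 := h (a - u)
  rw [← norm2_sq, Complex.norm_real, Real.norm_of_nonneg (by positivity)] at h3
  have h4 : (C + 1) * ∑' k, ‖((a - u : W.M) : H →L[ℂ] H) (z k)‖ ^ 2 < ε ^ 2 := by
    rw [lt_div_iff₀ (by positivity), mul_comm] at h2
    exact h2
  have e1 : 0 ≤ ∑' k, ‖((a - u : W.M) : H →L[ℂ] H) (z k)‖ ^ 2 :=
    tsum_nonneg fun _ => by positivity
  linarith

/-- The two terms of the resolvent identity contribute 1 and (1/2)², so 2(1 + 1/4) = 5/2 would also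
do. -/
theorem norm2_two_mul_resolv_sub_le (x y : W.M) :
    W.norm2 ((2 : ℂ) • (x * CStarAlgebra.resolv x) - (2 : ℂ) • (y * CStarAlgebra.resolv y)) ≤
      3 * W.norm2 (x - y) := by
  rw [← smul_sub, norm2_smul, CStarAlgebra.resolv_sub_resolv]
  have e : W.norm2 (star (y - x)) = W.norm2 (x - y) := by
    rw [norm2_star, norm2, norm2, toL2_sub, toL2_sub, norm_sub_rev]
  have h0 := W.norm2_nonneg (x - y)
  have h1 : W.norm2 (CStarAlgebra.resolv (star x) * (x - y) * CStarAlgebra.resolv y) ≤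
      W.norm2 (x - y) := by
    refine (W.norm2_mul_le _ _).trans ?_
    refine (mul_le_of_le_one_right (W.norm2_nonneg _) (CStarAlgebra.norm_resolv_le y)).trans ?_
    refine (W.norm2_mul_le' _ _).trans ?_
    exact mul_le_of_le_one_left h0 (CStarAlgebra.norm_resolv_le _)
  have h2 : W.norm2 (x * CStarAlgebra.resolv x * star (y - x) * (y * CStarAlgebra.resolv y)) ≤
      1 / 4 * W.norm2 (x - y) := by
    have hx := CStarAlgebra.norm_mul_resolv_le x
    have hy := CStarAlgebra.norm_mul_resolv_le y
    have k1 := W.norm2_mul_le (x * CStarAlgebra.resolv x * star (y - x))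
      (y * CStarAlgebra.resolv y)
    have k2 := W.norm2_mul_le' (x * CStarAlgebra.resolv x) (star (y - x))
    rw [e] at k2
    have k3 := mul_le_mul_of_nonneg_right hx h0
    have k4 := mul_le_mul_of_nonneg_left hy
      (W.norm2_nonneg (x * CStarAlgebra.resolv x * star (y - x)))
    linarith
  have h3 := W.norm2_add_le (CStarAlgebra.resolv (star x) * (x - y) * CStarAlgebra.resolv y)
    (x * CStarAlgebra.resolv x * star (y - x) * (y * CStarAlgebra.resolv y))
  rw [show ‖(2 : ℂ)‖ = 2 by simp]
  linarith

/-- The bicommutant of `S`, as a subalgebra of `M`. -/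
def bicommutant (S : StarSubalgebra ℂ W.M) : StarSubalgebra ℂ W.M :=
  (StarSubalgebra.centralizer ℂ (StarSubalgebra.centralizer ℂ
    (Subtype.val '' (S : Set W.M) : Set (H →L[ℂ] H)) : Set (H →L[ℂ] H))).comap
    W.vna.toStarSubalgebra.subtype

/-- `StarSubalgebra.centralizer` asks for commutation with adjoints as well; this is automatic
because S and its commutant are closed under the adjoint. -/
theorem mem_bicommutant {S : StarSubalgebra ℂ W.M} {u : W.M} :
    u ∈ W.bicommutant S ↔ W.IsInBicommutant S u := by
  have hS : ∀ g : H →L[ℂ] H, g ∈ (StarSubalgebra.centralizer ℂ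
      (Subtype.val '' (S : Set W.M) : Set (H →L[ℂ] H)) : Set (H →L[ℂ] H)) ↔
      ∀ a ∈ S, (a : H →L[ℂ] H) * g = g * a := by
    intro g
    rw [SetLike.mem_coe, StarSubalgebra.mem_centralizer_iff]
    constructor
    · exact fun h a ha => (h a ⟨a, ha, rfl⟩).1
    · rintro h _ ⟨a, ha, rfl⟩
      exact ⟨h a ha, h (star a) (star_mem ha)⟩
  rw [bicommutant, StarSubalgebra.mem_comap, StarSubalgebra.mem_centralizer_iff]
  constructor
  · exact fun h g hg => (h g ((hS g).2 hg)).1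
  · exact fun h g hg => ⟨h g ((hS g).1 hg), h (star g) ((hS _).1 (star_mem (S := StarSubalgebra ℂ (H →L[ℂ] H)) hg))⟩

theorem isClosed_bicommutant (S : StarSubalgebra ℂ W.M) :
    IsClosed (W.bicommutant S : Set W.M) := by
  have h : IsClosed (StarSubalgebra.centralizer ℂ (StarSubalgebra.centralizer ℂ
    (Subtype.val '' (S : Set W.M) : Set (H →L[ℂ] H)) : Set (H →L[ℂ] H)) : Set (H →L[ℂ] H)) := by
    rw [StarSubalgebra.coe_centralizer]
    exact Set.isClosed_centralizer _
  exact h.preimage continuous_subtype_val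

/-- Kaplansky's density theorem, for the norm of `L²(M, τ)`. -/
theorem exists_mem_norm_le_norm2_sub_lt {S : StarSubalgebra ℂ W.M} {u : W.M}
    (hu : W.IsInBicommutant S u) (hu1 : ‖u‖ ≤ 1) {ε : ℝ} (hε : 0 < ε) :
    ∃ a ∈ S, ‖a‖ ≤ 1 + ε ∧ W.norm2 (a - u) < ε := by
  obtain ⟨y, hy, rfl⟩ := CStarAlgebra.exists_mem_two_mul_resolv_eq (W.bicommutant S)
    (W.isClosed_bicommutant S) (W.mem_bicommutant.2 hu) hu1
  -- The preimage y of u is approximated with no control of the operator norm; the transform then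
  -- restores that control. The Lipschitz constant 3 turns ε/6 into ε/2.
  obtain ⟨x, hx, hxy⟩ := W.exists_mem_norm2_sub_lt (W.mem_bicommutant.1 hy)
    (show 0 < ε / 6 by positivity)
  set b := (2 : ℂ) • (x * CStarAlgebra.resolv x) with hb
  have hbS : b ∈ S.topologicalClosure := by
    have hx' := S.le_topologicalClosure hx
    exact SMulMemClass.smul_mem _ (mul_mem hx'
      (CStarAlgebra.resolv_mem _ S.isClosed_topologicalClosure hx'))
  have hb1 : ‖b‖ ≤ 1 := CStarAlgebra.norm_two_mul_resolv_le x
  -- The resolvent leaves S but stays in its norm closure; returning to S costs the slack in the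
  -- bound 1 + ε.
  obtain ⟨a, ha, hab⟩ := Metric.mem_closure_iff.1 hbS (ε / 2) (by positivity)
  rw [dist_comm, dist_eq_norm] at hab
  refine ⟨a, ha, ?_, ?_⟩
  · have := norm_add_le (a - b) b
    rw [sub_add_cancel] at this
    linarith
  · have h1 := W.norm2_add_le (a - b) (b - (2 : ℂ) • (y * CStarAlgebra.resolv y))
    rw [sub_add_sub_cancel] at h1
    have h2 := W.norm2_two_mul_resolv_sub_le x y
    rw [← hb] at h2
    have h3 := W.norm2_le_norm (a - b)
    linarith

end TracialWStarProbabilitySpace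
end

/-! ### Coassociativity of the derivative and slice maps -/

noncomputable section

namespace NCPoly

variable {n : ℕ}

theorem partialDeriv_algebraMap (j : Fin n) (r : ℂ) :
    partialDeriv j (algebraMap ℂ (FreeAlgebra ℂ (Fin n)) r) = 0 := by
  have h : (triangularHom j) (algebraMap ℂ (FreeAlgebra ℂ (Fin n)) r) =
    algebraMap ℂ _ r := AlgHom.commutes _ _
  change (triangularHom j) (algebraMap ℂ (FreeAlgebra ℂ (Fin n)) r) 0 1 = 0
  rw [h, Matrix.algebraMap_matrix_apply]
  simp

local notation "𝒫" => FreeAlgebra ℂ (Fin n)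

/-- The functional `f ⊗ g`. -/
def pair (f g : 𝒫 →ₗ[ℂ] ℂ) : 𝒫 ⊗[ℂ] 𝒫 →ₗ[ℂ] ℂ := LinearMap.mul' ℂ ℂ ∘ₗ TensorProduct.map f g

/-- The slice map `id ⊗ h`. -/
def sliceRight (h : 𝒫 →ₗ[ℂ] ℂ) : 𝒫 ⊗[ℂ] 𝒫 →ₗ[ℂ] 𝒫 :=
  (TensorProduct.rid ℂ 𝒫).toLinearMap ∘ₗ LinearMap.lTensor 𝒫 h

theorem pair_tmul (f g : 𝒫 →ₗ[ℂ] ℂ) (P Q : 𝒫) : pair f g (P ⊗ₜ Q) = f P * g Q := by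
  simp [pair]

theorem pair_add_right (f g h : 𝒫 →ₗ[ℂ] ℂ) (T : 𝒫 ⊗[ℂ] 𝒫) :
    pair f (g + h) T = pair f g T + pair f h T := by
  simp [pair, TensorProduct.map_add_right]

theorem sliceRight_tmul (h : 𝒫 →ₗ[ℂ] ℂ) (P Q : 𝒫) : sliceRight h (P ⊗ₜ Q) = h Q • P := by
  simp [sliceRight]

theorem pair_mul_one_tmul (f g : 𝒫 →ₗ[ℂ] ℂ) (T : 𝒫 ⊗[ℂ] 𝒫) (B : 𝒫) :
    pair f g (T * (1 ⊗ₜ B)) = pair f (g ∘ₗ LinearMap.mulRight ℂ B) T := by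
  induction T with
  | zero => simp
  | add S T hS hT => simp only [add_mul, map_add, hS, hT]
  | tmul P Q => simp [pair_tmul]

theorem pair_tmul_one_mul (f g : 𝒫 →ₗ[ℂ] ℂ) (T : 𝒫 ⊗[ℂ] 𝒫) (A : 𝒫) :
    pair f g ((A ⊗ₜ 1) * T) = pair (f ∘ₗ LinearMap.mulLeft ℂ A) g T := by
  induction T with
  | zero => simp
  | add S T hS hT => simp only [mul_add, map_add, hS, hT]
  | tmul P Q => simp [pair_tmul]

theorem pair_tmul_one_mul' (f g : 𝒫 →ₗ[ℂ] ℂ) (T : 𝒫 ⊗[ℂ] 𝒫) (A : 𝒫) :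
    pair f g ((A ⊗ₜ 1) * T) = f (A * sliceRight g T) := by
  induction T with
  | zero => simp
  | add S T hS hT => simp only [mul_add, map_add, hS, hT]
  | tmul P Q => simp [pair_tmul, sliceRight_tmul, mul_comm]

theorem sliceRight_mul_one_tmul (h : 𝒫 →ₗ[ℂ] ℂ) (T : 𝒫 ⊗[ℂ] 𝒫) (B : 𝒫) :
    sliceRight h (T * (1 ⊗ₜ B)) = sliceRight (h ∘ₗ LinearMap.mulRight ℂ B) T := by
  induction T with
  | zero => simp
  | add S T hS hT => simp only [add_mul, map_add, hS, hT]
  | tmul P Q => simp [sliceRight_tmul]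

theorem sliceRight_tmul_one_mul (h : 𝒫 →ₗ[ℂ] ℂ) (T : 𝒫 ⊗[ℂ] 𝒫) (A : 𝒫) :
    sliceRight h ((A ⊗ₜ 1) * T) = A * sliceRight h T := by
  induction T with
  | zero => simp
  | add S T hS hT => simp only [mul_add, map_add, hS, hT]
  | tmul P Q => simp [sliceRight_tmul]

theorem partialDeriv_one (j : Fin n) : partialDeriv j (1 : 𝒫) = 0 := by
  simpa using partialDeriv_algebraMap j 1

/-- Coassociativity of `∂ⱼ`, tested against product functionals. -/
theorem pair_partialDeriv_sliceRight (j : Fin n) (B : 𝒫) (f g h : 𝒫 →ₗ[ℂ] ℂ) :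
    pair f g (partialDeriv j (sliceRight h (partialDeriv j B))) =
      pair f (pair g h ∘ₗ partialDeriv j) (partialDeriv j B) := by
  -- The functionals must vary, since in a product the outer factors are absorbed into them.
  induction B using FreeAlgebra.induction generalizing f g h with
  | grade0 r => simp [partialDeriv_algebraMap]
  | grade1 i =>
    rw [partialDeriv_ι]
    split_ifs <;> simp [sliceRight_tmul, pair_tmul, partialDeriv_one]
  | add a b ha hb => simp only [map_add, ha, hb]
  | mul a b ha hb =>
    -- The Leibniz rule in the second leg of ∂a. Its last term matches the one from differentiating
    -- a · (id⊗h)(∂b) on the left-hand side.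
    have h1 : (pair g h ∘ₗ partialDeriv j) ∘ₗ LinearMap.mulRight ℂ b =
        pair g (h ∘ₗ LinearMap.mulRight ℂ b) ∘ₗ partialDeriv j +
          g ∘ₗ LinearMap.mulRight ℂ (sliceRight h (partialDeriv j b)) := by
      refine LinearMap.ext fun x => ?_
      simp only [LinearMap.comp_apply, LinearMap.mulRight_apply, LinearMap.add_apply,
        partialDeriv_mul, map_add, pair_mul_one_tmul, pair_tmul_one_mul']
    simp only [partialDeriv_mul, map_add, sliceRight_mul_one_tmul, sliceRight_tmul_one_mul,
      pair_mul_one_tmul, pair_tmul_one_mul, ha, hb, h1, pair_add_right, add_assoc]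

end NCPoly

namespace TracialWStarProbabilitySpace

variable {H : Type*} [NormedAddCommGroup H] [InnerProductSpace ℂ H] [CompleteSpace H]
  (W : TracialWStarProbabilitySpace H) {n : ℕ} (X : Fin n → W.M)

local notation "𝒫" => FreeAlgebra ℂ (Fin n)

open NCPoly

/-- The trace of `P(X)`. -/
def tr : 𝒫 →ₗ[ℂ] ℂ := W.τ ∘ₗ (W.eval X).toLinearMap

/-- `τ ⊗ τ` of the evaluation at `X`. -/
def tr₂ : 𝒫 ⊗[ℂ] 𝒫 →ₗ[ℂ] ℂ := W.ττ ∘ₗ (W.eval₂ X).toLinearMap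

/-- The slice map `τ ⊗ id`. -/
def sliceL : 𝒫 ⊗[ℂ] 𝒫 →ₗ[ℂ] 𝒫 :=
  (TensorProduct.lid ℂ 𝒫).toLinearMap ∘ₗ LinearMap.rTensor 𝒫 (W.tr X)

/-- The slice map `id ⊗ τ`. -/
def sliceR : 𝒫 ⊗[ℂ] 𝒫 →ₗ[ℂ] 𝒫 :=
  sliceRight (W.tr X)

theorem tr_apply (P : 𝒫) : W.tr X P = W.τ (W.eval X P) := rfl

theorem tr_mul_comm (P Q : 𝒫) : W.tr X (P * Q) = W.tr X (Q * P) := by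
  simp [tr_apply, W.τ_tracial (W.eval X P)]

theorem tr₂_tmul (P Q : 𝒫) : W.tr₂ X (P ⊗ₜ Q) = W.tr X P * W.tr X Q := by
  simp [tr₂, ττ, eval₂, tr_apply]

theorem sliceL_tmul (P Q : 𝒫) : W.sliceL X (P ⊗ₜ Q) = W.tr X P • Q := by
  simp [sliceL]

theorem sliceR_tmul (P Q : 𝒫) : W.sliceR X (P ⊗ₜ Q) = W.tr X Q • P := by
  simp [sliceR, sliceRight_tmul]

theorem sliceL_mul_one_tmul (T : 𝒫 ⊗[ℂ] 𝒫) (B : 𝒫) :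
    W.sliceL X (T * (1 ⊗ₜ B)) = W.sliceL X T * B := by
  induction T with
  | zero => simp
  | add S T hS hT => simp only [add_mul, map_add, hS, hT]
  | tmul P Q => simp [sliceL_tmul]

theorem tr₂_mul_one_tmul (T : 𝒫 ⊗[ℂ] 𝒫) (B : 𝒫) :
    W.tr₂ X (T * (1 ⊗ₜ B)) = W.tr X (W.sliceL X T * B) := by
  induction T with
  | zero => simp
  | add S T hS hT => simp only [add_mul, map_add, hS, hT]
  | tmul P Q => simp [sliceL_tmul, tr₂_tmul]

theorem tr₂_tmul_one_mul (T : 𝒫 ⊗[ℂ] 𝒫) (A : 𝒫) :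
    W.tr₂ X ((A ⊗ₜ 1) * T) = W.tr X (A * W.sliceR X T) := by
  induction T with
  | zero => simp
  | add S T hS hT => simp only [mul_add, map_add, hS, hT]
  | tmul P Q => simp [sliceR_tmul, tr₂_tmul, mul_comm]

theorem tr₂_mul_tmul (T : 𝒫 ⊗[ℂ] 𝒫) (C D : 𝒫) :
    W.tr₂ X (T * (C ⊗ₜ D)) = W.tr₂ X ((C ⊗ₜ 1) * T * (1 ⊗ₜ D)) := by
  induction T with
  | zero => simp
  | add S T hS hT => simp only [mul_add, add_mul, map_add, hS, hT]
  | tmul P Q => simp [tr₂_tmul, W.tr_mul_comm X P]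

theorem pair_tr_tr : pair (W.tr X) (W.tr X) = W.tr₂ X :=
  TensorProduct.ext' fun P Q => by rw [pair_tmul, tr₂_tmul]

/-- Both sides are the functional τ(A ·) ⊗ τ ⊗ τ of the twofold derivative of B, once computed as
(∂⊗id)∂ and once as (id⊗∂)∂. This yields the cancellation in `norm_adj_sq_eq`. -/
theorem tr₂_partialDeriv_sliceR (j : Fin n) (A B : 𝒫) :
    W.tr₂ X ((A ⊗ₜ 1) * partialDeriv j (W.sliceR X (partialDeriv j B))) =
      W.tr₂ X (partialDeriv j (W.sliceL X ((A ⊗ₜ 1) * partialDeriv j B))) := by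
  have h1 : W.tr₂ X ((A ⊗ₜ 1) * partialDeriv j (W.sliceR X (partialDeriv j B))) =
      pair (W.tr X ∘ₗ LinearMap.mulLeft ℂ A) (pair (W.tr X) (W.tr X) ∘ₗ partialDeriv j)
        (partialDeriv j B) := by
    rw [← pair_tr_tr, pair_tmul_one_mul]
    exact pair_partialDeriv_sliceRight _ _ _ _ _
  have h2 (T : 𝒫 ⊗[ℂ] 𝒫) : W.tr₂ X (partialDeriv j (W.sliceL X ((A ⊗ₜ 1) * T))) =
      pair (W.tr X ∘ₗ LinearMap.mulLeft ℂ A) (W.tr₂ X ∘ₗ partialDeriv j) T := by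
    induction T with
    | zero => simp
    | add S T hS hT => simp only [mul_add, map_add, hS, hT]
    | tmul P Q => simp [sliceL_tmul, pair_tmul]
  rw [h1, h2, pair_tr_tr]

end TracialWStarProbabilitySpace
end

/-! ### Dabrowski's inequality -/

noncomputable section

/-- A sequence with `aⱼ² ≤ s aⱼ₊₁` that grows at most like `2ʲ r ^ 2ʲ` starts below `s r`. -/
theorem le_mul_of_sq_le_mul_succ {a : ℕ → ℝ} {s r α β : ℝ} (hs : 0 ≤ s) (hr : 0 < r)
    (h : ∀ j, a j ^ 2 ≤ s * a (j + 1)) (hb : ∀ j, a j ≤ (α + 2 ^ j * β) * r ^ 2 ^ j) :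
    a 0 ≤ s * r := by
  by_contra! hlt
  have hs' : 0 < s := by
    rcases hs.eq_or_lt with rfl | hs'
    · have h0 := h 0
      rw [zero_mul] at h0 hlt
      nlinarith [pow_pos hlt 2]
    · exact hs'
  set q := a 0 / (s * r) with hq
  have hq1 : 1 < q := (one_lt_div (by positivity)).2 hlt
  have hq0 : 0 < q := by linarith
  -- If a₀ = s r q with q > 1, the recursion propagates the excess to q^(2^j), which outgrows the
  -- factor α + 2^j β.
  have hlow : ∀ j, s * (r * q) ^ 2 ^ j ≤ a j := by
    intro j
    induction j with
    | zero =>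
      have : a 0 = s * (r * q) := by rw [hq]; field_simp
      rw [pow_zero, pow_one, ← this]
    | succ j ih =>
      have h1 : (s * (r * q) ^ 2 ^ j) ^ 2 ≤ s * a (j + 1) :=
        (pow_le_pow_left₀ (by positivity) ih 2).trans (h j)
      have h2 : (s * (r * q) ^ 2 ^ j) ^ 2 = s * (s * (r * q) ^ 2 ^ (j + 1)) := by
        rw [pow_succ 2 j, pow_mul]; ring
      rw [h2] at h1
      exact le_of_mul_le_mul_left h1 hs'
  -- The exponents 0 and 1 present both terms as m^k / q^m along m = 2^j, which tends to 0.
  have hle : ∀ j, s ≤ α * ((2 ^ j : ℕ) ^ 0 / q ^ 2 ^ j) + β * (((2 ^ j : ℕ) : ℝ) ^ 1 / q ^ 2 ^ j) := by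
    intro j
    have h1 := (hlow j).trans (hb j)
    rw [mul_pow, mul_left_comm, mul_comm (α + 2 ^ j * β)] at h1
    have h2 := le_of_mul_le_mul_left h1 (by positivity)
    have h3 : α * (((2 ^ j : ℕ) : ℝ) ^ 0 / q ^ 2 ^ j) + β * (((2 ^ j : ℕ) : ℝ) ^ 1 / q ^ 2 ^ j) =
        (α + 2 ^ j * β) / q ^ 2 ^ j := by
      push_cast; ring
    rw [h3, le_div_iff₀ (by positivity)]
    exact h2
  have hpow : Filter.Tendsto (fun j : ℕ => 2 ^ j) Filter.atTop Filter.atTop :=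
    tendsto_pow_atTop_atTop_of_one_lt (by norm_num : (1 : ℕ) < 2)
  have ht := (((tendsto_pow_const_div_const_pow_of_one_lt 0 hq1).comp hpow).const_mul α).add
    (((tendsto_pow_const_div_const_pow_of_one_lt 1 hq1).comp hpow).const_mul β)
  have := ge_of_tendsto' ht hle
  linarith

namespace TracialWStarProbabilitySpace

attribute [local instance] isClosed_vna

variable {H : Type*} [NormedAddCommGroup H] [InnerProductSpace ℂ H] [CompleteSpace H]
  (W : TracialWStarProbabilitySpace H) {n : ℕ} (X : Fin n → W.M)

local notation "𝒫" => FreeAlgebra ℂ (Fin n)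

open NCPoly

/-- The antilinear map `a ⊗ b ↦ b* ⊗ a*`. -/
def flipStar (T : W.M ⊗[ℂ] W.M) : W.M ⊗[ℂ] W.M := Algebra.TensorProduct.comm ℂ W.M W.M (star T)

theorem flipStar_add (S T : W.M ⊗[ℂ] W.M) :
    W.flipStar (S + T) = W.flipStar S + W.flipStar T := by simp [flipStar]

theorem flipStar_zero : W.flipStar 0 = 0 := by simp [flipStar]

theorem flipStar_tmul (a b : W.M) : W.flipStar (a ⊗ₜ b) = star b ⊗ₜ star a := by
  simp [flipStar, TensorProduct.star_tmul]

theorem flipStar_mul_one_tmul (T : W.M ⊗[ℂ] W.M) (b : W.M) :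
    W.flipStar (T * (1 ⊗ₜ b)) = (star b ⊗ₜ 1) * W.flipStar T := by
  induction T with
  | zero => simp [flipStar_zero]
  | add S T hS hT => simp only [add_mul, mul_add, flipStar_add, hS, hT]
  | tmul P Q => simp [flipStar_tmul]

theorem flipStar_tmul_one_mul (T : W.M ⊗[ℂ] W.M) (a : W.M) :
    W.flipStar ((a ⊗ₜ 1) * T) = W.flipStar T * (1 ⊗ₜ star a) := by
  induction T with
  | zero => simp [flipStar_zero]
  | add S T hS hT => simp only [add_mul, mul_add, flipStar_add, hS, hT]
  | tmul P Q => simp [flipStar_tmul]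

theorem flipStar_flipStar (T : W.M ⊗[ℂ] W.M) : W.flipStar (W.flipStar T) = T := by
  induction T with
  | zero => simp [flipStar_zero]
  | add S T hS hT => simp only [flipStar_add, hS, hT]
  | tmul P Q => simp [flipStar_tmul]

theorem ττ_flipStar (T : W.M ⊗[ℂ] W.M) : W.ττ (W.flipStar T) = star (W.ττ T) := by
  induction T with
  | zero => simp [flipStar_zero]
  | add S T hS hT => simp only [flipStar_add, map_add, hS, hT, star_add]
  | tmul P Q => simp [flipStar_tmul, ττ, τ_star, mul_comm]

/-- `B(X) = A(X)*` and the evaluations of `∂ⱼ A` and `∂ⱼ B` correspond to each other under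
`a ⊗ b ↦ b* ⊗ a*`. -/
def StarPair (j : Fin n) (A B : 𝒫) : Prop :=
  W.eval X B = star (W.eval X A) ∧
    W.eval₂ X (partialDeriv j B) = W.flipStar (W.eval₂ X (partialDeriv j A))

variable {W X}

theorem eval₂_tmul (P Q : 𝒫) : W.eval₂ X (P ⊗ₜ Q) = W.eval X P ⊗ₜ W.eval X Q := by
  simp [eval₂]

theorem StarPair.symm {j : Fin n} {A B : 𝒫} (h : W.StarPair X j A B) : W.StarPair X j B A := by
  refine ⟨?_, ?_⟩
  · rw [h.1, star_star]
  · rw [h.2, flipStar_flipStar]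

theorem StarPair.mul {j : Fin n} {A B C D : 𝒫} (h : W.StarPair X j A B)
    (h' : W.StarPair X j C D) : W.StarPair X j (A * C) (D * B) := by
  refine ⟨?_, ?_⟩
  · rw [map_mul, map_mul, star_mul, h.1, h'.1]
  · simp only [partialDeriv_mul, map_add, map_mul, eval₂_tmul, map_one, flipStar_add,
      flipStar_mul_one_tmul, flipStar_tmul_one_mul, h.1, h'.1, h.2, h'.2]
    rw [add_comm]

theorem StarPair.pow {j : Fin n} {C : 𝒫} (h : W.StarPair X j C C) (m : ℕ) :
    W.StarPair X j (C ^ m) (C ^ m) := by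
  induction m with
  | zero => exact ⟨by simp, by simp [partialDeriv_one, flipStar_zero]⟩
  | succ m ih =>
    have := ih.mul h
    rwa [← pow_succ', ← pow_succ] at this

/-- Reverse the words of A and conjugate the coefficients; self-adjointness of the generators makes
this evaluate to the adjoint. -/
theorem exists_starPair (hX : ∀ i, IsSelfAdjoint (X i)) (j : Fin n) (A : 𝒫) :
    ∃ B, W.StarPair X j A B := by
  induction A using FreeAlgebra.induction with
  | grade0 r =>
    refine ⟨algebraMap ℂ _ (star r), ?_, ?_⟩
    · rw [AlgHom.commutes, AlgHom.commutes, ← algebraMap_star_comm]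
    · simp [partialDeriv_algebraMap, flipStar_zero]
  | grade1 i =>
    refine ⟨FreeAlgebra.ι ℂ i, ?_, ?_⟩
    · simp [eval, (hX i).star_eq]
    · rw [partialDeriv_ι]
      split_ifs
      · simp [eval₂_tmul, flipStar_tmul]
      · simp [flipStar_zero]
  | mul a b ha hb =>
    obtain ⟨a', ha⟩ := ha
    obtain ⟨b', hb⟩ := hb
    exact ⟨_, ha.mul hb⟩
  | add a b ha hb =>
    obtain ⟨a', ha⟩ := ha
    obtain ⟨b', hb⟩ := hb
    refine ⟨a' + b', ?_, ?_⟩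
    · rw [map_add, map_add, star_add, ha.1, hb.1]
    · simp only [map_add, flipStar_add, ha.2, hb.2]

theorem eval_sliceR_eq {S T : 𝒫 ⊗[ℂ] 𝒫} (h : W.eval₂ X S = W.flipStar (W.eval₂ X T)) :
    W.eval X (W.sliceR X S) = star (W.eval X (W.sliceL X T)) := by
  let R : W.M ⊗[ℂ] W.M →ₗ[ℂ] W.M :=
    (TensorProduct.rid ℂ W.M).toLinearMap ∘ₗ LinearMap.lTensor W.M W.τ
  have hR (S : 𝒫 ⊗[ℂ] 𝒫) : W.eval X (W.sliceR X S) = R (W.eval₂ X S) := by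
    induction S with
    | zero => simp
    | add S T hS hT => simp only [map_add, hS, hT]
    | tmul P Q => simp [sliceR_tmul, eval₂_tmul, R, tr_apply]
  rw [hR, h]
  clear h
  induction T with
  | zero => simp [flipStar_zero]
  | add S T hS hT => simp only [map_add, flipStar_add, star_add, hS, hT]
  | tmul P Q => simp [sliceL_tmul, eval₂_tmul, flipStar_tmul, R, tr_apply, τ_star]

variable (W X) in
/-- The vector `ξ A(X) - (τ ⊗ id)((∂ⱼ A)(X))`. -/
def adj (j : Fin n) (ξ : W.L2) (A : 𝒫) : W.L2 :=
  W.rmul (W.eval X A) ξ - W.toL2 (W.eval X (W.sliceL X (partialDeriv j A)))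

theorem τMul_sub (x y : W.L2) (a : W.M) : W.τMul (x - y) a = W.τMul x a - W.τMul y a :=
  inner_sub_right _ _ _

variable (W X) in
/-- The conjugate relation for the `j`-th variable. -/
def ConjugateRelation (j : Fin n) (ξ : W.L2) : Prop :=
  ∀ P : 𝒫, W.tr₂ X (partialDeriv j P) = W.τMul ξ (W.eval X P)

theorem eval_mul (P Q : 𝒫) : W.eval X (P * Q) = W.eval X P * W.eval X Q := map_mul _ _ _

variable {j : Fin n} {ξ : W.L2}

/-- The conjugate relation for AB splits by the Leibniz rule, and the part ∂A(1⊗B) is what the slice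
in `adj` subtracts. Thus `adj` plays the role of the adjoint of ∂ on elementary tensors with one
trivial leg. -/
theorem τMul_adj (hξ : W.ConjugateRelation X j ξ) (A B : 𝒫) :
    W.τMul (W.adj X j ξ A) (W.eval X B) = W.tr₂ X ((A ⊗ₜ 1) * partialDeriv j B) := by
  rw [adj, τMul_sub, τMul_rmul, τMul_toL2, ← eval_mul, ← eval_mul, ← hξ, ← tr_apply,
    ← tr₂_mul_one_tmul, partialDeriv_mul, map_add, add_sub_cancel_left]

theorem rmul_adj (A B : 𝒫) :
    W.rmul (W.eval X B) (W.adj X j ξ A) = W.adj X j ξ (A * B) +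
      W.toL2 (W.eval X (W.sliceL X ((A ⊗ₜ 1) * partialDeriv j B))) := by
  have h1 : W.rmul (W.eval X B) (W.rmul (W.eval X A) ξ) = W.rmul (W.eval X (A * B)) ξ := by
    refine W.denseRange_toL2.induction_on
      (p := fun ξ => W.rmul (W.eval X B) (W.rmul (W.eval X A) ξ) = W.rmul (W.eval X (A * B)) ξ) ξ
      (isClosed_eq (by fun_prop) (by fun_prop)) fun b => ?_
    simp only [rmul_toL2, eval_mul, mul_assoc]
  rw [adj, adj, map_sub, h1, rmul_toL2, partialDeriv_mul, map_add, sliceL_mul_one_tmul, map_add,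
    eval_mul (W.sliceL X _), toL2_add]
  abel

/-- Expresses that ξ acts as a self-adjoint vector: conjugate the relation for the adjoint
polynomial, using that a⊗b ↦ b*⊗a* conjugates τ⊗τ. -/
theorem inner_conjugate_toL2 (hX : ∀ i, IsSelfAdjoint (X i)) (hξ : W.ConjugateRelation X j ξ)
    (C : 𝒫) : inner ℂ ξ (W.toL2 (W.eval X C)) = W.tr₂ X (partialDeriv j C) := by
  obtain ⟨C', h1, h2⟩ := exists_starPair hX j C
  have h3 := hξ C'
  change W.ττ (W.eval₂ X (partialDeriv j C')) = _ at h3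
  rw [h2, ττ_flipStar, τMul, h1, star_star] at h3
  have h4 := congrArg star h3
  rw [star_star, ← starRingEnd_apply, inner_conj_symm] at h4
  exact h4.symm

/-- Expand the first vector only. Moving A across from ξA produces the right-hand side plus a
second-order term; the slice part produces the same term by coassociativity, and the two cancel. -/
theorem norm_adj_sq_eq (hX : ∀ i, IsSelfAdjoint (X i)) (hξ : W.ConjugateRelation X j ξ)
    {A B : 𝒫} (h : W.StarPair X j A B) :
    inner ℂ (W.adj X j ξ A) (W.adj X j ξ A) = inner ℂ ξ (W.adj X j ξ (A * B)) := by
  have h1 : inner ℂ (W.rmul (W.eval X A) ξ) (W.adj X j ξ A) =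
      inner ℂ ξ (W.adj X j ξ (A * B)) +
        W.tr₂ X (partialDeriv j (W.sliceL X ((A ⊗ₜ 1) * partialDeriv j B))) := by
    rw [inner_rmul, ← h.1, rmul_adj, inner_add_right, inner_conjugate_toL2 hX hξ]
  have h2 : inner ℂ (W.toL2 (W.eval X (W.sliceL X (partialDeriv j A)))) (W.adj X j ξ A) =
      W.tr₂ X ((A ⊗ₜ 1) * partialDeriv j (W.sliceR X (partialDeriv j B))) := by
    rw [← τMul_adj hξ, τMul, eval_sliceR_eq h.2, star_star]
  nth_rewrite 1 [adj]
  rw [inner_sub_left, h1, h2, tr₂_partialDeriv_sliceR, add_sub_cancel_right]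

theorem norm_adj_sq_le (hX : ∀ i, IsSelfAdjoint (X i)) (hξ : W.ConjugateRelation X j ξ)
    {A B : 𝒫} (h : W.StarPair X j A B) :
    ‖W.adj X j ξ A‖ ^ 2 ≤ ‖ξ‖ * ‖W.adj X j ξ (A * B)‖ := by
  have h1 := norm_inner_le_norm (𝕜 := ℂ) ξ (W.adj X j ξ (A * B))
  rw [← norm_adj_sq_eq hX hξ h, inner_self_eq_norm_sq_to_K] at h1
  simpa using h1

/-- A crude bound from T being a finite sum of simple tensors. The size of K is irrelevant, as it
only enters the growth rate of powers. -/
theorem exists_norm2_sliceL_le (T : 𝒫 ⊗[ℂ] 𝒫) : ∃ K : ℝ, 0 ≤ K ∧ ∀ A : 𝒫,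
    W.norm2 (W.eval X (W.sliceL X ((A ⊗ₜ 1) * T))) ≤ K * ‖W.eval X A‖ := by
  induction T with
  | zero => exact ⟨0, le_rfl, by simp [norm2, toL2_zero]⟩
  | add S T hS hT =>
    obtain ⟨K, hK, h⟩ := hS
    obtain ⟨L, hL, h'⟩ := hT
    refine ⟨K + L, add_nonneg hK hL, fun A => ?_⟩
    rw [mul_add, map_add, map_add, add_mul]
    exact (W.norm2_add_le _ _).trans (add_le_add (h A) (h' A))
  | tmul P Q =>
    refine ⟨W.norm2 (W.eval X P) * W.norm2 (W.eval X Q),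
      mul_nonneg (W.norm2_nonneg _) (W.norm2_nonneg _), fun A => ?_⟩
    rw [Algebra.TensorProduct.tmul_mul_tmul, one_mul, sliceL_tmul, map_smul, norm2_smul, tr_apply,
      eval_mul]
    have h1 := (W.norm_τ_mul_le (W.eval X A) (W.eval X P)).trans
      (mul_le_mul_of_nonneg_right (W.norm2_le_norm (W.eval X A)) (W.norm2_nonneg _))
    have h2 := mul_le_mul_of_nonneg_right h1 (W.norm2_nonneg (W.eval X Q))
    linarith

theorem norm_pow_le_of_norm_le {a : W.M} {r : ℝ} (ha : ‖a‖ ≤ r) (m : ℕ) : ‖a ^ m‖ ≤ r ^ m := by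
  have hr : 0 ≤ r := (norm_nonneg a).trans ha
  induction m with
  | zero =>
    rw [pow_zero, pow_zero]
    exact ContinuousLinearMap.norm_id_le
  | succ m ih =>
    rw [pow_succ, pow_succ]
    exact (norm_mul_le _ _).trans (mul_le_mul ih ha (norm_nonneg _) (pow_nonneg hr m))

/-- By the Leibniz rule ∂(C^m) has m terms, each contributing at most K r^(m−1); hence β = K/r. -/
theorem exists_norm_adj_pow_le (ξ : W.L2) (C : 𝒫) {r : ℝ} (hr : 0 < r) (hC : ‖W.eval X C‖ ≤ r) :
    ∃ β : ℝ, ∀ m : ℕ, ‖W.adj X j ξ (C ^ m)‖ ≤ (‖ξ‖ + m * β) * r ^ m := by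
  obtain ⟨K, hK, h⟩ := exists_norm2_sliceL_le (W := W) (X := X) (partialDeriv j C)
  refine ⟨K / r, fun m => ?_⟩
  have hpow (m : ℕ) : ‖W.eval X (C ^ m)‖ ≤ r ^ m := by
    rw [map_pow]
    exact norm_pow_le_of_norm_le hC m
  have hs : W.norm2 (W.eval X (W.sliceL X (partialDeriv j (C ^ m)))) ≤ m * (K / r) * r ^ m := by
    induction m with
    | zero => simp [partialDeriv_one, norm2, toL2_zero]
    | succ m ih =>
      rw [pow_succ C, partialDeriv_mul, map_add, sliceL_mul_one_tmul, map_add, eval_mul]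
      refine (W.norm2_add_le _ _).trans ?_
      have h1 := (W.norm2_mul_le (W.eval X (W.sliceL X (partialDeriv j (C ^ m))))
        (W.eval X C)).trans (mul_le_mul ih hC (norm_nonneg _) (by positivity))
      have h2 := (h (C ^ m)).trans (mul_le_mul_of_nonneg_left (hpow m) hK)
      refine (add_le_add h1 h2).trans (le_of_eq ?_)
      push_cast
      field_simp
      ring
  have h1 := W.norm_rmul_apply_le (W.eval X (C ^ m)) ξ
  have h2 := norm_sub_le (W.rmul (W.eval X (C ^ m)) ξ)
    (W.toL2 (W.eval X (W.sliceL X (partialDeriv j (C ^ m)))))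
  have h3 := mul_le_mul_of_nonneg_right (hpow m) (norm_nonneg ξ)
  rw [norm2] at hs
  rw [adj]
  linarith

/-- Dabrowski's inequality. -/
theorem norm_adj_le (hX : ∀ i, IsSelfAdjoint (X i)) (hξ : W.ConjugateRelation X j ξ) (A : 𝒫) :
    ‖W.adj X j ξ A‖ ≤ ‖ξ‖ * ‖W.eval X A‖ := by
  obtain ⟨B, hB⟩ := exists_starPair hX j A
  have hC : W.StarPair X j (A * B) (A * B) := hB.mul hB.symm
  have hCn : ‖W.eval X (A * B)‖ = ‖W.eval X A‖ ^ 2 := by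
    rw [eval_mul, hB.1, CStarRing.norm_self_mul_star, sq]
  -- Strict inequality keeps r positive even if A(X) = 0; the limit r ↓ ‖A(X)‖² is taken afterwards.
  have h1 : ∀ r : ℝ, ‖W.eval X A‖ ^ 2 < r → ‖W.adj X j ξ (A * B)‖ ≤ ‖ξ‖ * r := by
    intro r hr
    have hr0 : 0 < r := (sq_nonneg _).trans_lt hr
    obtain ⟨β, hβ⟩ := exists_norm_adj_pow_le (j := j) ξ (A * B) hr0 (hCn.le.trans hr.le)
    have := le_mul_of_sq_le_mul_succ (a := fun k => ‖W.adj X j ξ ((A * B) ^ 2 ^ k)‖)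
      (α := ‖ξ‖) (β := β) (norm_nonneg ξ) hr0 (fun k => ?_) (fun k => ?_)
    · simpa using this
    · have h := norm_adj_sq_le hX hξ (hC.pow (2 ^ k))
      rwa [← pow_add, ← two_mul, ← pow_succ'] at h
    · have h := hβ (2 ^ k)
      push_cast at h
      exact h
  have h2 : ‖W.adj X j ξ (A * B)‖ ≤ ‖ξ‖ * ‖W.eval X A‖ ^ 2 := by
    refine ge_of_tendsto (x := nhdsWithin (‖W.eval X A‖ ^ 2) (Set.Ioi (‖W.eval X A‖ ^ 2)))
      (f := fun r => ‖ξ‖ * r) ?_ (Filter.eventually_of_mem self_mem_nhdsWithin h1)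
    exact ((continuous_const.mul continuous_id).tendsto _).mono_left nhdsWithin_le_nhds
  refine (pow_le_pow_iff_left₀ (norm_nonneg _) (by positivity) two_ne_zero).1 ?_
  -- One more Cauchy–Schwarz step passes from AA* back to A.
  calc _ ≤ ‖ξ‖ * ‖W.adj X j ξ (A * B)‖ := norm_adj_sq_le hX hξ hB
    _ ≤ ‖ξ‖ * (‖ξ‖ * ‖W.eval X A‖ ^ 2) := by gcongr
    _ = _ := by ring

theorem norm2_sliceL_partialDeriv_le (hX : ∀ i, IsSelfAdjoint (X i))
    (hξ : W.ConjugateRelation X j ξ) (A : 𝒫) :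
    W.norm2 (W.eval X (W.sliceL X (partialDeriv j A))) ≤ 2 * ‖ξ‖ * ‖W.eval X A‖ := by
  have h1 := norm_adj_le hX hξ A
  have h2 := W.norm_rmul_apply_le (W.eval X A) ξ
  have h3 := norm_sub_le (W.rmul (W.eval X A) ξ) (W.adj X j ξ A)
  have h4 : W.rmul (W.eval X A) ξ - W.adj X j ξ A =
    W.toL2 (W.eval X (W.sliceL X (partialDeriv j A))) := by rw [adj]; abel
  rw [h4] at h3
  rw [norm2]
  linarith

theorem norm2_sliceR_partialDeriv_le (hX : ∀ i, IsSelfAdjoint (X i))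
    (hξ : W.ConjugateRelation X j ξ) (A : 𝒫) :
    W.norm2 (W.eval X (W.sliceR X (partialDeriv j A))) ≤ 2 * ‖ξ‖ * ‖W.eval X A‖ := by
  obtain ⟨B, hB⟩ := exists_starPair hX j A
  rw [eval_sliceR_eq hB.symm.2, norm2_star]
  have h := norm2_sliceL_partialDeriv_le hX hξ B
  rwa [hB.1, norm_star] at h

/-! ### The estimate for polynomial u and v -/

/-- Write (C⊗1)∂B = ∂(CB) − ∂C(1⊗B) and slice the first leg by τ; the slice bound gives 2 + 2. -/
theorem norm_tr₂_left_le (hX : ∀ i, IsSelfAdjoint (X i)) (hξ : W.ConjugateRelation X j ξ)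
    (B C E : 𝒫) :
    ‖W.tr₂ X ((C ⊗ₜ 1) * partialDeriv j B * (1 ⊗ₜ E))‖ ≤
      4 * ‖ξ‖ * ‖W.eval X C‖ * ‖W.eval X B‖ * W.norm2 (W.eval X E) := by
  have h1 : (C ⊗ₜ 1) * partialDeriv j B =
      partialDeriv j (C * B) - partialDeriv j C * (1 ⊗ₜ[ℂ] B) := by
    rw [partialDeriv_mul, add_sub_cancel_left]
  rw [h1, tr₂_mul_one_tmul, map_sub, sliceL_mul_one_tmul, sub_mul, map_sub, tr_apply, tr_apply,
    eval_mul, eval_mul (W.sliceL X (partialDeriv j C) * B), eval_mul (W.sliceL X _) B]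
  refine (norm_sub_le _ _).trans ?_
  have e := W.norm2_nonneg (W.eval X E)
  have hCB : ‖W.eval X (C * B)‖ ≤ ‖W.eval X C‖ * ‖W.eval X B‖ := by
    rw [eval_mul]
    exact norm_mul_le _ _
  have k1 := (W.norm_τ_mul_le (W.eval X (W.sliceL X (partialDeriv j (C * B)))) (W.eval X E)).trans
    (mul_le_mul_of_nonneg_right ((norm2_sliceL_partialDeriv_le hX hξ (C * B)).trans
      (mul_le_mul_of_nonneg_left hCB (by positivity))) e)
  have k2 := (W.norm_τ_mul_le (W.eval X (W.sliceL X (partialDeriv j C)) * W.eval X B)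
    (W.eval X E)).trans (mul_le_mul_of_nonneg_right ((W.norm2_mul_le _ _).trans
      (mul_le_mul_of_nonneg_right (norm2_sliceL_partialDeriv_le hX hξ C)
        (norm_nonneg (W.eval X B)))) e)
  linarith

/-- Write ∂A(1⊗E) = ∂(AE) − (A⊗1)∂E, so that no derivative of A alone remains. The first term pairs
AE with `adj` of C and costs 1, the second uses the slice of ∂E and costs 2. -/
theorem norm_tr₂_right_le (hX : ∀ i, IsSelfAdjoint (X i)) (hξ : W.ConjugateRelation X j ξ)
    (A C E : 𝒫) :
    ‖W.tr₂ X ((C ⊗ₜ 1) * partialDeriv j A * (1 ⊗ₜ E))‖ ≤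
      3 * ‖ξ‖ * ‖W.eval X C‖ * W.norm2 (W.eval X A) * ‖W.eval X E‖ := by
  have h1 : (C ⊗ₜ 1) * partialDeriv j A * (1 ⊗ₜ E) =
      (C ⊗ₜ 1) * partialDeriv j (A * E) - ((C * A) ⊗ₜ 1) * partialDeriv j E := by
    have h2 : (C * A) ⊗ₜ[ℂ] (1 : 𝒫) = (C ⊗ₜ 1) * (A ⊗ₜ 1) := by simp
    rw [partialDeriv_mul, h2, mul_add, mul_assoc, mul_assoc, add_sub_cancel_right]
  rw [h1, map_sub, ← τMul_adj hξ, tr₂_tmul_one_mul, tr_apply, eval_mul, eval_mul, eval_mul]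
  refine (norm_sub_le _ _).trans ?_
  have k1 := (W.norm_τMul_le (W.adj X j ξ C) (W.eval X A * W.eval X E)).trans
    (mul_le_mul (norm_adj_le hX hξ C) (W.norm2_mul_le _ _) (W.norm2_nonneg _) (by positivity))
  have k2 := (W.norm_τ_mul_le (W.eval X C * W.eval X A)
    (W.eval X (W.sliceR X (partialDeriv j E)))).trans
    (mul_le_mul (W.norm2_mul_le' _ _) (norm2_sliceR_partialDeriv_le hX hξ E)
      (W.norm2_nonneg _) (mul_nonneg (norm_nonneg _) (W.norm2_nonneg _)))
  linarith

theorem norm_tr₂_partialDeriv_le (hX : ∀ i, IsSelfAdjoint (X i))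
    (hξ : W.ConjugateRelation X j ξ) (P B U C D : 𝒫) :
    ‖W.tr₂ X ((B ⊗ₜ 1) * partialDeriv j P * (1 ⊗ₜ U) * (C ⊗ₜ D))‖ ≤
      4 * ‖ξ‖ * (W.norm2 (W.eval X P * W.eval X U) * ‖W.eval X B‖ +
        ‖W.eval X U‖ * W.norm2 (W.eval X B * W.eval X P)) *
        (‖W.eval X C‖ * ‖W.eval X D‖) := by
  -- The Leibniz rule for BP removes ∂P: in the first term BP is measured in the 2-norm, in the
  -- second PU is. Traciality in the first leg has already moved C to the left.
  have h1 : (C ⊗ₜ 1) * ((B ⊗ₜ 1) * partialDeriv j P * (1 ⊗ₜ U)) * (1 ⊗ₜ D) =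
      (C ⊗ₜ 1) * partialDeriv j (B * P) * (1 ⊗ₜ[ℂ] (U * D)) -
        (C ⊗ₜ 1) * partialDeriv j B * (1 ⊗ₜ (P * (U * D))) := by
    have h2 : (1 : 𝒫) ⊗ₜ[ℂ] (P * (U * D)) = (1 ⊗ₜ P) * ((1 ⊗ₜ U) * (1 ⊗ₜ D)) := by simp
    have h3 : (1 : 𝒫) ⊗ₜ[ℂ] (U * D) = (1 ⊗ₜ U) * (1 ⊗ₜ D) := by simp
    rw [partialDeriv_mul, h2, h3]
    noncomm_ring
  rw [tr₂_mul_tmul, h1, map_sub]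
  refine (norm_sub_le _ _).trans ?_
  have k1 := norm_tr₂_right_le hX hξ (B * P) C (U * D)
  have k2 := norm_tr₂_left_le hX hξ B C (P * (U * D))
  rw [eval_mul B P, eval_mul U D] at k1
  rw [← mul_assoc P, eval_mul (P * U), eval_mul P U] at k2
  have e1 := W.norm2_nonneg (W.eval X B * W.eval X P)
  have e2 := W.norm2_mul_le (W.eval X P * W.eval X U) (W.eval X D)
  have e3 := norm_mul_le (W.eval X U) (W.eval X D)
  have m1 := mul_le_mul_of_nonneg_left e3
    (show 0 ≤ 3 * ‖ξ‖ * ‖W.eval X C‖ * W.norm2 (W.eval X B * W.eval X P) by positivity)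
  have m2 := mul_le_mul_of_nonneg_left e2
    (show 0 ≤ 4 * ‖ξ‖ * ‖W.eval X C‖ * ‖W.eval X B‖ by positivity)
  -- Slack that raises the constant 3 of the first term to the common 4.
  have m3 : 0 ≤ ‖ξ‖ * ‖W.eval X C‖ * W.norm2 (W.eval X B * W.eval X P) *
    (‖W.eval X U‖ * ‖W.eval X D‖) := by positivity
  rw [← mul_assoc P]
  linarith

end TracialWStarProbabilitySpace
end

/-! ### Passage to vN(X) and to the projective norm -/

noncomputable section

namespace TracialWStarProbabilitySpace

open Filter Topology NCPoly

attribute [local instance] isClosed_vna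

variable {H : Type*} [NormedAddCommGroup H] [InnerProductSpace ℂ H] [CompleteSpace H]
  {W : TracialWStarProbabilitySpace H} {n : ℕ} {X : Fin n → W.M}

variable (W) in
/-- The algebra `ℂ⟨X⟩` as a *-algebra, for self-adjoint `X`. -/
def polyStarAlg (hX : ∀ i, IsSelfAdjoint (X i)) : StarSubalgebra ℂ W.M where
  toSubalgebra := W.polyAlg X
  star_mem' := W.star_mem_polyAlg hX

theorem isInBicommutant_of_mem_vN (hX : ∀ i, IsSelfAdjoint (X i)) {u : W.M} (hu : u ∈ W.vN X) :
    W.IsInBicommutant (W.polyStarAlg hX) u := by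
  intro g hg
  let R : Set (H →L[ℂ] H) := Set.range fun i => (X i : H →L[ℂ] H)
  -- The bicommutant of the generators is one of the von Neumann algebras over which `vN`
  -- intersects; three commutants reduce to one.
  let N : VonNeumannAlgebra H :=
    { toStarSubalgebra := StarSubalgebra.centralizer ℂ
        (StarSubalgebra.centralizer ℂ R : Set (H →L[ℂ] H))
      centralizer_centralizer' := by
        change Set.centralizer (Set.centralizer (StarSubalgebra.centralizer ℂ
          (StarSubalgebra.centralizer ℂ R : Set (H →L[ℂ] H)) : Set (H →L[ℂ] H))) =
            (StarSubalgebra.centralizer ℂ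
          (StarSubalgebra.centralizer ℂ R : Set (H →L[ℂ] H)) : Set (H →L[ℂ] H))
        rw [StarSubalgebra.coe_centralizer, Set.centralizer_centralizer_centralizer] }
  have hXN : ∀ i, (X i : H →L[ℂ] H) ∈ N := by
    intro i
    change (X i : H →L[ℂ] H) ∈ StarSubalgebra.centralizer ℂ
        (StarSubalgebra.centralizer ℂ R : Set (H →L[ℂ] H))
    rw [StarSubalgebra.mem_centralizer_iff]
    intro z hz
    have h1 := star_mem (S := StarSubalgebra ℂ (H →L[ℂ] H)) hz
    rw [SetLike.mem_coe, StarSubalgebra.mem_centralizer_iff] at hz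
    rw [StarSubalgebra.mem_centralizer_iff] at h1
    exact ⟨(hz _ ⟨i, rfl⟩).1.symm, (h1 _ ⟨i, rfl⟩).1.symm⟩
  have hgR : g ∈ StarSubalgebra.centralizer ℂ R := by
    rw [StarSubalgebra.mem_centralizer_iff]
    rintro _ ⟨i, rfl⟩
    have h1 : X i ∈ W.polyStarAlg hX := ⟨FreeAlgebra.ι ℂ i, by simp [eval]⟩
    exact ⟨hg _ h1, hg _ (star_mem h1)⟩
  have huN : (u : H →L[ℂ] H) ∈ StarSubalgebra.centralizer ℂ
    (StarSubalgebra.centralizer ℂ R : Set (H →L[ℂ] H)) := hu N hXN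
  rw [StarSubalgebra.mem_centralizer_iff] at huN
  exact (huN g hgR).1

/-- Kaplansky's density theorem for `ℂ⟨X⟩ ⊆ vN(X)`. -/
theorem exists_seq_tendsto_toL2 (hX : ∀ i, IsSelfAdjoint (X i)) {u : W.M} (hu : u ∈ W.vN X) :
    ∃ a : ℕ → FreeAlgebra ℂ (Fin n),
      (∀ k, ‖W.eval X (a k)‖ ≤ ‖u‖ * (1 + 1 / ((k : ℝ) + 1))) ∧
      Tendsto (fun k => W.toL2 (W.eval X (a k))) atTop (𝓝 (W.toL2 u)) := by
  rcases eq_or_ne u 0 with rfl | hu0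
  · exact ⟨0, by simp, by simp⟩
  -- Kaplansky's theorem is applied to u/‖u‖ with ε = 1/(k + 1), then rescaled.
  have hu1 : 0 < ‖u‖ := norm_pos_iff.2 hu0
  set c : ℂ := (‖u‖ : ℂ) with hc
  have hc0 : c ≠ 0 := by rw [hc]; exact_mod_cast hu1.ne'
  have hcn : ‖c‖ = ‖u‖ := by simp [hc]
  have hbi : W.IsInBicommutant (W.polyStarAlg hX) (c⁻¹ • u) :=
    W.mem_bicommutant.1 (SMulMemClass.smul_mem _
      (W.mem_bicommutant.2 (isInBicommutant_of_mem_vN hX hu)))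
  have hn : ‖c⁻¹ • u‖ ≤ 1 := by
    rw [norm_smul, norm_inv, hcn, inv_mul_cancel₀ hu1.ne']
  have hex (k : ℕ) : ∃ p : FreeAlgebra ℂ (Fin n), ‖W.eval X p‖ ≤ 1 + 1 / ((k : ℝ) + 1) ∧
      W.norm2 (W.eval X p - c⁻¹ • u) < 1 / ((k : ℝ) + 1) := by
    obtain ⟨_, ⟨p, rfl⟩, h⟩ := W.exists_mem_norm_le_norm2_sub_lt hbi hn
      (show 0 < 1 / ((k : ℝ) + 1) by positivity)
    exact ⟨p, h⟩
  choose p hp1 hp2 using hex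
  refine ⟨fun k => c • p k, fun k => ?_, ?_⟩
  · rw [map_smul, norm_smul, hcn]
    exact mul_le_mul_of_nonneg_left (hp1 k) hu1.le
  · have h1 : Tendsto (fun k => W.toL2 (W.eval X (p k))) atTop (𝓝 (W.toL2 (c⁻¹ • u))) := by
      rw [tendsto_iff_norm_sub_tendsto_zero]
      refine squeeze_zero (fun _ => norm_nonneg _) (fun k => ?_)
        tendsto_one_div_add_atTop_nhds_zero_nat
      rw [← toL2_sub]
      exact (hp2 k).le
    have h2 := h1.const_smul c
    rw [← toL2_smul, smul_smul, mul_inv_cancel₀ hc0, one_smul] at h2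
    simpa only [map_smul, toL2_smul] using h2

theorem tendsto_norm2_mul {u : W.M} {a : ℕ → W.M}
    (h : Tendsto (fun k => W.toL2 (a k)) atTop (𝓝 (W.toL2 u))) (p : W.M) :
    Tendsto (fun k => W.norm2 (p * a k)) atTop (𝓝 (W.norm2 (p * u))) := by
  have h1 : Tendsto (fun k => W.toL2 (p * a k)) atTop (𝓝 (W.toL2 (p * u))) := by
    rw [tendsto_iff_norm_sub_tendsto_zero] at h ⊢
    refine squeeze_zero (fun _ => norm_nonneg _) (fun k => ?_)
      (by simpa using h.const_mul ‖p‖)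
    rw [← toL2_sub, ← toL2_sub, ← mul_sub]
    exact W.norm2_mul_le' _ _
  exact h1.norm

/-- On simple tensors the expression is a product of two L² inner products, one in each variable, so
2-norm convergence suffices. -/
theorem tendsto_ττ {u v : W.M} {a b : ℕ → W.M}
    (ha : Tendsto (fun k => W.toL2 (a k)) atTop (𝓝 (W.toL2 u)))
    (hb : Tendsto (fun k => W.toL2 (b k)) atTop (𝓝 (W.toL2 v))) (T : W.M ⊗[ℂ] W.M) (c d : W.M) :
    Tendsto (fun k => W.ττ ((star (b k) ⊗ₜ 1) * T * (1 ⊗ₜ a k) * (c ⊗ₜ d))) atTop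
      (𝓝 (W.ττ ((star v ⊗ₜ 1) * T * (1 ⊗ₜ u) * (c ⊗ₜ d)))) := by
  induction T with
  | zero => simp
  | add S T hS hT =>
    simp only [mul_add, add_mul, map_add]
    exact hS.add hT
  | tmul x y =>
    have h (a b : W.M) : W.ττ ((star b ⊗ₜ 1) * (x ⊗ₜ y) * (1 ⊗ₜ a) * (c ⊗ₜ d)) =
        inner ℂ (W.toL2 b) (W.toL2 (x * c)) * inner ℂ (W.toL2 (star (d * y))) (W.toL2 a) := by
      rw [inner_toL2, inner_toL2, star_star]
      simp only [Algebra.TensorProduct.tmul_mul_tmul, one_mul, mul_one, ττ, LinearMap.comp_apply,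
        TensorProduct.map_tmul, LinearMap.mul'_apply]
      rw [W.τ_tracial (y * a), mul_assoc, mul_assoc]
    simp only [h]
    exact (hb.inner tendsto_const_nhds).mul (tendsto_const_nhds.inner ha)

theorem norm_ττ_partialDeriv_le (hX : ∀ i, IsSelfAdjoint (X i)) {j : Fin n} {ξ : W.L2}
    (hξ : W.ConjugateRelation X j ξ) (P : FreeAlgebra ℂ (Fin n)) {u v : W.M} (hu : u ∈ W.vN X)
    (hv : v ∈ W.vN X) {c d : W.M} (hc : c ∈ W.polyAlg X) (hd : d ∈ W.polyAlg X) :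
    ‖W.ττ ((star v ⊗ₜ 1) * W.eval₂ X (partialDeriv j P) * (1 ⊗ₜ u) * (c ⊗ₜ d))‖ ≤
      4 * ‖ξ‖ * (W.norm2 (W.eval X P * u) * ‖v‖ + ‖u‖ * W.norm2 (star (W.eval X P) * v)) *
        (‖c‖ * ‖d‖) := by
  obtain ⟨C, rfl⟩ := hc
  obtain ⟨D, rfl⟩ := hd
  change ‖W.ττ (_ * (W.eval X C ⊗ₜ W.eval X D))‖ ≤ _ * (‖W.eval X C‖ * ‖W.eval X D‖)
  obtain ⟨a, ha1, ha⟩ := exists_seq_tendsto_toL2 hX hu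
  obtain ⟨b, hb1, hb⟩ := exists_seq_tendsto_toL2 hX hv
  have hlim : Tendsto (fun k : ℕ => 1 + 1 / ((k : ℝ) + 1)) atTop (𝓝 1) := by
    simpa using (tendsto_one_div_add_atTop_nhds_zero_nat (𝕜 := ℝ)).const_add 1
  have hlhs := (tendsto_ττ ha hb (W.eval₂ X (partialDeriv j P)) (W.eval X C) (W.eval X D)).norm
  have hrhs := (((((tendsto_norm2_mul ha (W.eval X P)).mul (hlim.const_mul ‖v‖)).add
    ((hlim.const_mul ‖u‖).mul (tendsto_norm2_mul hb (star (W.eval X P))))).const_mul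
      (4 * ‖ξ‖)).mul_const (‖W.eval X C‖ * ‖W.eval X D‖))
  rw [mul_one, mul_one] at hrhs
  refine le_of_tendsto_of_tendsto' hlhs hrhs fun k => ?_
  -- The polynomial estimate takes v* in its first leg, so b k is replaced by a polynomial
  -- evaluating to its adjoint.
  obtain ⟨B, hB⟩ := exists_starPair hX j (b k)
  have h1 := norm_tr₂_partialDeriv_le hX hξ P B (a k) C D
  have h2 : W.tr₂ X ((B ⊗ₜ 1) * partialDeriv j P * (1 ⊗ₜ a k) * (C ⊗ₜ D)) =
      W.ττ ((star (W.eval X (b k)) ⊗ₜ 1) * W.eval₂ X (partialDeriv j P) * (1 ⊗ₜ W.eval X (a k)) *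
        (W.eval X C ⊗ₜ W.eval X D)) := by
    simp only [tr₂, LinearMap.comp_apply, AlgHom.toLinearMap_apply, map_mul, eval₂_tmul, hB.1,
      map_one]
  have h3 : W.norm2 (star (W.eval X (b k)) * W.eval X P) =
      W.norm2 (star (W.eval X P) * W.eval X (b k)) := by
    rw [← norm2_star, star_mul, star_star]
  rw [h2, hB.1, norm_star, h3] at h1
  refine h1.trans ?_
  have e1 := W.norm2_nonneg (W.eval X P * W.eval X (a k))
  have e2 := W.norm2_nonneg (star (W.eval X P) * W.eval X (b k))
  gcongr
  · exact hb1 k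
  · exact ha1 k

theorem norm_ip_le (hX : ∀ i, IsSelfAdjoint (X i)) {j : Fin n} {ξ : W.L2}
    (hξ : W.ConjugateRelation X j ξ) (P : FreeAlgebra ℂ (Fin n)) {u v : W.M} (hu : u ∈ W.vN X)
    (hv : v ∈ W.vN X) (Q : W.polyAlg X ⊗[ℂ] W.polyAlg X) :
    ‖W.ip ((star v ⊗ₜ[ℂ] 1) * W.eval₂ X (partialDeriv j P) * (1 ⊗ₜ[ℂ] u)) (W.inclTensor X Q)‖ ≤
      4 * ‖ξ‖ * (W.norm2 (W.eval X P * u) * ‖v‖ + ‖u‖ * W.norm2 (star (W.eval X P) * v)) *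
        W.projNorm X Q := by
  set K := 4 * ‖ξ‖ * (W.norm2 (W.eval X P * u) * ‖v‖ + ‖u‖ * W.norm2 (star (W.eval X P) * v))
    with hK
  have hK0 : 0 ≤ K := by
    have e1 := W.norm2_nonneg (W.eval X P * u)
    have e2 := W.norm2_nonneg (star (W.eval X P) * v)
    positivity
  have hne : {r : ℝ | ∃ (N : ℕ) (q₁ q₂ : Fin N → W.polyAlg X),
      Q = ∑ k, q₁ k ⊗ₜ[ℂ] q₂ k ∧ r = ∑ k, ‖(q₁ k : W.M)‖ * ‖(q₂ k : W.M)‖}.Nonempty := by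
    obtain ⟨N, q₁, q₂, h⟩ : ∃ (N : ℕ) (q₁ q₂ : Fin N → W.polyAlg X),
        Q = ∑ k, q₁ k ⊗ₜ[ℂ] q₂ k := by
      induction Q with
      | zero => exact ⟨0, 0, 0, by simp⟩
      | tmul p q => exact ⟨1, fun _ => p, fun _ => q, by simp⟩
      | add S T hS hT =>
        obtain ⟨N, q₁, q₂, rfl⟩ := hS
        obtain ⟨N', p₁, p₂, rfl⟩ := hT
        exact ⟨N + N', Fin.append q₁ p₁, Fin.append q₂ p₂, by simp [Fin.sum_univ_add]⟩
    exact ⟨_, N, q₁, q₂, h, rfl⟩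
  -- As K ≥ 0 passes inside the infimum, it suffices to bound by each decomposition separately.
  rw [projNorm, ← smul_eq_mul K, ← Real.sInf_smul_of_nonneg hK0]
  refine le_csInf hne.smul_set ?_
  rintro _ ⟨_, ⟨N, q₁, q₂, hQ, rfl⟩, rfl⟩
  have hstar : star (W.inclTensor X Q) = ∑ k, star (q₁ k : W.M) ⊗ₜ[ℂ] star (q₂ k : W.M) := by
    simp [hQ, inclTensor, TensorProduct.star_tmul]
  change ‖W.ττ _‖ ≤ K • _
  rw [hstar, Finset.mul_sum, map_sum, smul_eq_mul, Finset.mul_sum]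
  refine (norm_sum_le _ _).trans (Finset.sum_le_sum fun k _ => ?_)
  -- The pairing involves Q*, whose legs are again polynomials of the same norms.
  have h := norm_ττ_partialDeriv_le hX hξ P hu hv (W.star_mem_polyAlg hX (q₁ k).2)
    (W.star_mem_polyAlg hX (q₂ k).2)
  rwa [norm_star, norm_star] at h

end TracialWStarProbabilitySpace
end

theorem proposition3p5 {H : Type*} [NormedAddCommGroup H] [InnerProductSpace ℂ H]
    [CompleteSpace H] (W : TracialWStarProbabilitySpace H) {n : ℕ} (X : Fin n → W.M)
    (hX : ∀ i, IsSelfAdjoint (X i)) (hΦ : W.fisherInfo X < ∞)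
    (ξ : Fin n → W.L2) (hξ : W.IsConjugateSystem X ξ)
    (P : FreeAlgebra ℂ (Fin n)) (u v : W.M) (hu : u ∈ W.vN X) (hv : v ∈ W.vN X)
    (Q : W.polyAlg X ⊗[ℂ] W.polyAlg X) :
    (∀ i : Fin n,
      ‖W.ip ((star v ⊗ₜ[ℂ] 1) * W.eval₂ X (NCPoly.partialDeriv i P) * (1 ⊗ₜ[ℂ] u))
          (W.inclTensor X Q)‖ ≤
        4 * ‖ξ i‖ * (W.norm2 (W.eval X P * u) * ‖v‖ + ‖u‖ * W.norm2 (star (W.eval X P) * v)) *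
          W.projNorm X Q) ∧
    ∑ i : Fin n,
      ‖W.ip ((star v ⊗ₜ[ℂ] 1) * W.eval₂ X (NCPoly.partialDeriv i P) * (1 ⊗ₜ[ℂ] u))
          (W.inclTensor X Q)‖ ^ 2 ≤
        16 * (W.norm2 (W.eval X P * u) * ‖v‖ + ‖u‖ * W.norm2 (star (W.eval X P) * v)) ^ 2 *
          (W.fisherInfo X).toReal * W.projNorm X Q ^ 2 := by

  have key (i : Fin n) := TracialWStarProbabilitySpace.norm_ip_le hX (j := i) (ξ := ξ i)
    (fun P => hξ.conjugate_relations i P) P hu hv Q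
  refine ⟨key, ?_⟩
  -- Uniqueness of conjugate systems lets the Fisher information be computed with the given ξ;
  -- squaring and summing then gives 16 = 4².
  rw [hξ.fisherInfo_eq W hX, ENNReal.toReal_sum fun _ _ => ENNReal.ofReal_ne_top]
  simp only [ENNReal.toReal_ofReal (sq_nonneg _)]
  rw [Finset.mul_sum, Finset.sum_mul]
  refine Finset.sum_le_sum fun i _ => ?_
  refine (pow_le_pow_left₀ (norm_nonneg _) (key i) 2).trans (le_of_eq ?_)
  ring
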